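/- For a complex $m\times m$ matrix $U$ let $\mathrm{Sc}_j(U)$ be the secular coefficients, $\det(I+xU)=\sum_{j=0}^{m}\mathrm{Sc}_j(U)x^j$. For integers $N\ge 0$ let $\mathrm{Sp}(2N)$ be the compact group of unitary complex $2N\times 2N$ matrices $U$ with $UJU^{T}=J$, where $J=\begin{pmatrix}0&-I_N\\ I_N&0\end{pmatrix}$, let $dU$ be its Haar probability measure, and for $k\ge 1$ put $$I^S_{d_k,2}(n;N)=\int_{\mathrm{Sp}(2N)}\Bigl|\sum_{\substack{j_1+\cdots+j_k=n\\ 0\le j_1,\dots,j_k\le 2N}}\mathrm{Sc}_{j_1}(U)\cdots\mathrm{Sc}_{j_k}(U)\Bigr|^2\,dU .$$ Then for all integers $0\le n\le 2N$, $$I^S_{d_1,2}(n;N)=\int_{\mathrm{Sp}(2N)}|\mathrm{Sc}_n(U)|^2\,dU=\begin{cases}\left\lfloor \frac{n+2}{2}\right\rfloor & 0\le n\le N,\\[2pt] \left\lfloor \frac{2N-n+2}{2}\right\rfloor & N+1\le n\le 2N.\end{cases}$$ Moreover, let $\gamma(c)=c/2$ for $0\le c\le 1$ and $\gamma(c)=(2-c)/2$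 for $1\le c\le 2$, and let $(n_i,N_i)_{i\ge 0}$ be any sequence of pairs of non-negative integers with $n_i\le 2N_i$ and $N_i\to\infty$. (i) If $n_i\to\infty$ and $2N_i-n_i\to\infty$, then $I^S_{d_1,2}(n_i;N_i)\sim\gamma(n_i/N_i)\,N_i$, that is, the quotient of the two sides tends to $1$. (ii) If $n_i/N_i\to c$, then $I^S_{d_1,2}(n_i;N_i)/N_i\to\gamma(c)$; if in addition $0<c<2$, then $I^S_{d_1,2}(n_i;N_i)\sim\gamma(c)\,N_i$. (This includes the case where $n_i/N_i=c$ is fixed.) -/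

import Mathlib

open Filter Topology MeasureTheory Asymptotics

noncomputable section

/-- The secular coefficient `Sc_j(U)`: the coefficient of `x ^ j` in `det (1 + x U)`. -/
def secularCoeff {m : Type*} [Fintype m] [DecidableEq m] (j : ℕ) (U : Matrix m m ℂ) : ℂ :=
  (Matrix.det (1 + (Polynomial.X : Polynomial ℂ) • U.map Polynomial.C)).coeff j

/-- The unitary symplectic group `Sp(2N)`, consisting of the unitary `2N × 2N` matrices `U` with
`U J Uᵀ = J`, as a subgroup of the unitary group (with the topology of entrywise convergence). -/
def unitarySymplectic (N : ℕ) : Subgroup (Matrix.unitaryGroup (Fin N ⊕ Fin N) ℂ) where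
  carrier := {U | (U : Matrix (Fin N ⊕ Fin N) (Fin N ⊕ Fin N) ℂ) ∈
    Matrix.symplecticGroup (Fin N) ℂ}
  mul_mem' := fun {_ _} ha hb => (Matrix.symplecticGroup (Fin N) ℂ).mul_mem ha hb
  one_mem' := (Matrix.symplecticGroup (Fin N) ℂ).one_mem
  inv_mem' := by
    intro U hU
    have h1 := (⟨U.1, hU⟩ : Matrix.symplecticGroup (Fin N) ℂ)⁻¹.2
    rw [SymplecticGroup.coe_inv'] at h1
    have h2 : ((U⁻¹ : Matrix.unitaryGroup (Fin N ⊕ Fin N) ℂ) :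
        Matrix (Fin N ⊕ Fin N) (Fin N ⊕ Fin N) ℂ) = (U.1)⁻¹ := by
      symm
      apply Matrix.inv_eq_left_inv
      rw [← Submonoid.coe_mul, inv_mul_cancel, Submonoid.coe_one]
    change ((U⁻¹ : Matrix.unitaryGroup (Fin N ⊕ Fin N) ℂ) :
        Matrix (Fin N ⊕ Fin N) (Fin N ⊕ Fin N) ℂ) ∈ Matrix.symplecticGroup (Fin N) ℂ
    rw [h2]
    exact h1

instance unitarySymplectic.instCompactSpace (N : ℕ) : CompactSpace (unitarySymplectic N) := by
  let f : unitarySymplectic N → Matrix (Fin N ⊕ Fin N) (Fin N ⊕ Fin N) ℂ := fun U => U.1.1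
  have hf : IsEmbedding f := IsEmbedding.subtypeVal.comp IsEmbedding.subtypeVal
  have hr : Set.range f = {A | A * star A = 1} ∩
      {A | A * Matrix.J (Fin N) ℂ * A.transpose = Matrix.J (Fin N) ℂ} := by
    ext A
    constructor
    · rintro ⟨U, rfl⟩
      exact ⟨Matrix.mem_unitaryGroup_iff.1 U.1.2, SymplecticGroup.mem_iff.1 U.2⟩
    · rintro ⟨h1, h2⟩
      exact ⟨⟨⟨A, Matrix.mem_unitaryGroup_iff.2 h1⟩, SymplecticGroup.mem_iff.2 h2⟩, rfl⟩
  have hc : IsClosed (Set.range f) := by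
    rw [hr]
    refine IsClosed.inter (isClosed_eq ?_ continuous_const) (isClosed_eq ?_ continuous_const)
    · exact continuous_id.matrix_mul continuous_id.star
    · exact (continuous_id.matrix_mul continuous_const).matrix_mul continuous_id.matrix_transpose
  have hK : IsCompact (Set.pi Set.univ fun _ : Fin N ⊕ Fin N => Set.pi Set.univ
      fun _ : Fin N ⊕ Fin N => Metric.closedBall (0 : ℂ) 1) :=
    isCompact_univ_pi fun _ => isCompact_univ_pi fun _ => isCompact_closedBall _ _
  have hsub : Set.range f ⊆ (Set.pi Set.univ fun _ : Fin N ⊕ Fin N => Set.pi Set.univ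
      fun _ : Fin N ⊕ Fin N => Metric.closedBall (0 : ℂ) 1) := by
    rintro _ ⟨U, rfl⟩ i _ j _
    simpa using entry_norm_bound_of_unitary U.1.2 i j
  have hR : IsCompact (Set.range f) := hK.of_isClosed_subset hc hsub
  exact ⟨by rw [hf.isInducing.isCompact_iff, Set.image_univ]; exact hR⟩

instance unitarySymplectic.instMeasurableSpace (N : ℕ) : MeasurableSpace (unitarySymplectic N) :=
  borel _

instance unitarySymplectic.instBorelSpace (N : ℕ) : BorelSpace (unitarySymplectic N) := ⟨rfl⟩

/-- The Haar probability measure on `Sp(2N)`: the Haar measure giving the whole group mass `1`. -/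
def unitarySymplecticHaar (N : ℕ) : Measure (unitarySymplectic N) := Measure.haarMeasure ⊤

instance unitarySymplecticHaar.instIsHaarMeasure (N : ℕ) :
    (unitarySymplecticHaar N).IsHaarMeasure := by
  unfold unitarySymplecticHaar; infer_instance

instance unitarySymplecticHaar.instIsProbabilityMeasure (N : ℕ) :
    IsProbabilityMeasure (unitarySymplecticHaar N) :=
  ⟨by simpa [unitarySymplecticHaar] using
    Measure.haarMeasure_self (G := unitarySymplectic N) (K₀ := ⊤)⟩

/-- `I_{d_k,2}^S(n; N)`: the integral over `U ∈ Sp(2N)` of the squared modulus of the sum of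
`Sc_{j_1}(U) ⋯ Sc_{j_k}(U)` over all `0 ≤ j_1, …, j_k ≤ 2N` with `j_1 + ⋯ + j_k = n`. -/
def divisorIntegral (k n N : ℕ) : ℝ :=
  ∫ U : unitarySymplectic N,
    ‖∑ j : Fin k → Fin (2 * N + 1) with ∑ i, (j i : ℕ) = n,
      ∏ i, secularCoeff (j i : ℕ) U.1.1‖ ^ 2 ∂(unitarySymplecticHaar N)

/-- The coefficient `γ(c)` of the main term, for `0 ≤ c ≤ 2`. -/
def gammaSymplectic (c : ℝ) : ℝ := if c ≤ 1 then c / 2 else (2 - c) / 2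

end

/-! `Sc_n(U)` is the sum of the principal `n × n` minors of `U`, hence the character of the exterior
power `Λ^n` of the standard representation. For a unitary representation of a compact group, the
mean square of the character is the dimension of the commutant (`integral_norm_trace_sq`). The exact
formula thus amounts to showing that the commutant of `Sp(2N)` on `Λ^n` has dimension `n / 2 + 1`
(natural division) when `n ≤ N`. The range `n > N` follows from `|Sc_{2N-n}| = |Sc_n|` on unitary
matrices (`norm_secularCoeff_sub`).

Lower bound (`le_finrank_matrixCommutant`): wedging with the invariant bivector `∑ e_i ∧ f_i` embeds
`Λ^m` equivariantly in `Λ^(m+2)`. It is injective for `m < N` by the `sl₂` commutation relation, and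
for `m + 2 ≤ N` it is not onto, because binomial coefficients increase below the middle. Each such
embedding raises the dimension of the commutant by at least one.

Upper bound (`finrank_matrixCommutant_le`): call a site, that is, an index of a hyperbolic plane
`⟨e_s, f_s⟩`, paired in a wedge of basis vectors if both vectors occur. A wedge `w₀` with at most
one unpaired site generates `Λ^n`, so an intertwiner `T` is determined by `T w₀`. Torus elements
force `T w₀` into the weight space of `w₀`. Site permutations fixing `w₀` up to sign leave one
unknown for each number of pairs shared with `w₀`, and this number lies between `0` and `n / 2`. No
decomposition into irreducibles is needed.

For the asymptotics, the main term `γ(n/N) N` equals `min n (2N - n) / 2`, so it differs from the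
integral by at most `1`. -/

/-- The matrices commuting with every value of a matrix representation. -/
def matrixCommutant {G d : Type*} [Fintype d] [DecidableEq d] [Group G]
    (A : G →* Matrix d d ℂ) : Submodule ℂ (Matrix d d ℂ) where
  carrier := {T | ∀ g, A g * T = T * A g}
  add_mem' := fun {S T} hS hT g => by rw [mul_add, add_mul, hS g, hT g]
  zero_mem' := fun g => by simp
  smul_mem' := fun c T hT g => by rw [mul_smul_comm, smul_mul_assoc, hT g]

/-! ### Averaging over a compact group: characters and commutants. -/

section Averaging

variable {G d : Type*} [Fintype d] [DecidableEq d] [Group G] [TopologicalSpace G]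
  [IsTopologicalGroup G] [CompactSpace G] [MeasurableSpace G] [BorelSpace G]

lemma integrable_conj_entry (μ : Measure G) [IsProbabilityMeasure μ] {A : G →* Matrix d d ℂ}
    (hA : ∀ i j, Continuous fun g => A g i j) (T : Matrix d d ℂ) (i j : d) :
    Integrable (fun g => (A g * T * A g⁻¹) i j) μ := by
  have hc : Continuous fun g => (A g * T * A g⁻¹) i j := by
    simp only [Matrix.mul_apply]
    refine continuous_finsetSum _ fun k _ => ?_
    refine (continuous_finsetSum _ fun l _ => ?_).mul ((hA k j).comp continuous_inv)
    exact (hA i l).mul continuous_const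
  exact hc.integrable_of_hasCompactSupport (HasCompactSupport.of_compactSpace _)

/-- The average `∫ A(g) T A(g)⁻¹ dg`, as a linear operator on matrices. -/
noncomputable def averageConj (μ : Measure G) [IsProbabilityMeasure μ] {A : G →* Matrix d d ℂ}
    (hA : ∀ i j, Continuous fun g => A g i j) : Matrix d d ℂ →ₗ[ℂ] Matrix d d ℂ where
  toFun T := Matrix.of fun i j => ∫ g, (A g * T * A g⁻¹) i j ∂μ
  map_add' S T := by
    ext i j
    simp only [Matrix.of_apply, Matrix.add_apply]
    rw [← integral_add (integrable_conj_entry μ hA S i j) (integrable_conj_entry μ hA T i j)]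
    simp [mul_add, add_mul]
  map_smul' c T := by
    ext i j
    simp only [Matrix.of_apply, Matrix.smul_apply, RingHom.id_apply, smul_eq_mul]
    rw [← integral_const_mul]
    simp

/-- Left invariance of `μ` makes every average commute with the representation; total mass one makes
the average fix what already commutes. -/
lemma isProj_averageConj (μ : Measure G) [IsProbabilityMeasure μ] [μ.IsMulLeftInvariant]
    {A : G →* Matrix d d ℂ} (hA : ∀ i j, Continuous fun g => A g i j) :
    LinearMap.IsProj (matrixCommutant A) (averageConj μ hA) := by
  have hinv : ∀ g, A g * A g⁻¹ = 1 := fun g => by rw [← map_mul, mul_inv_cancel, map_one]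
  have hinv' : ∀ g, A g⁻¹ * A g = 1 := fun g => by rw [← map_mul, inv_mul_cancel, map_one]
  constructor
  · intro T h
    have key : A h * averageConj μ hA T * A h⁻¹ = averageConj μ hA T := by
      ext i j
      have h1 : (A h * averageConj μ hA T * A h⁻¹) i j =
          ∫ g, (A h * (A g * T * A g⁻¹) * A h⁻¹) i j ∂μ := by
        simp only [Matrix.mul_apply (M := A h * _) (N := A h⁻¹), Matrix.mul_apply (M := A h)]
        rw [integral_finsetSum]
        · refine Finset.sum_congr rfl fun k _ => ?_
          rw [integral_mul_const, integral_finsetSum]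
          · congr 1
            refine Finset.sum_congr rfl fun l _ => ?_
            rw [integral_const_mul]
            rfl
          · exact fun l _ => (integrable_conj_entry μ hA T l k).const_mul _
        · exact fun k _ => (integrable_finsetSum _ fun l _ =>
            (integrable_conj_entry μ hA T l k).const_mul _).mul_const _
      rw [h1]
      have h2 : ∀ g, A h * (A g * T * A g⁻¹) * A h⁻¹ = A (h * g) * T * A (h * g)⁻¹ := fun g => by
        rw [mul_inv_rev, map_mul, map_mul]
        simp only [mul_assoc]
      simp_rw [h2]
      exact integral_mul_left_eq_self (fun g => (A g * T * A g⁻¹) i j) h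
    calc A h * averageConj μ hA T = A h * averageConj μ hA T * (A h⁻¹ * A h) := by
          rw [hinv', mul_one]
      _ = A h * averageConj μ hA T * A h⁻¹ * A h := by simp only [mul_assoc]
      _ = _ := by rw [key]
  · intro T hT
    ext i j
    have : ∀ g, A g * T * A g⁻¹ = T := fun g => by rw [hT g, mul_assoc, hinv, mul_one]
    simp [averageConj, this]

/-- The mean square of a unitary character is the dimension of the commutant. -/
theorem integral_norm_trace_sq (μ : Measure G) [IsProbabilityMeasure μ] [μ.IsMulLeftInvariant]
    {A : G →* Matrix d d ℂ} (hA : ∀ i j, Continuous fun g => A g i j)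
    (hstar : ∀ g, A g⁻¹ = (A g).conjTranspose) :
    ∫ g, ‖(A g).trace‖ ^ 2 ∂μ = Module.finrank ℂ (matrixCommutant A) := by
  -- The trace of a projection is the dimension of its image. The same trace is now computed in the
  -- basis of matrix units.
  have h1 := (isProj_averageConj μ hA).trace
  rw [LinearMap.trace_eq_matrix_trace ℂ (Matrix.stdBasis ℂ d d), Matrix.trace] at h1
  have h2 : ∀ p : d × d, (LinearMap.toMatrix (Matrix.stdBasis ℂ d d) (Matrix.stdBasis ℂ d d)
      (averageConj μ hA)).diag p = ∫ g, A g p.1 p.1 * A g⁻¹ p.2 p.2 ∂μ := by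
    rintro ⟨i, j⟩
    rw [Matrix.diag_apply, LinearMap.toMatrix_apply, Matrix.stdBasis_eq_single]
    simp only [averageConj, LinearMap.coe_mk, AddHom.coe_mk]
    have hrepr : ∀ M : Matrix d d ℂ, (Matrix.stdBasis ℂ d d).repr M (i, j) = M i j := fun M => rfl
    rw [hrepr, Matrix.of_apply]
    congr 1
    ext g
    rw [Matrix.mul_apply, Finset.sum_eq_single j]
    · rw [Matrix.mul_single_apply_same, mul_one]
    · intro k _ hk
      rw [Matrix.mul_single_apply_of_ne _ _ _ _ _ (by simpa using hk), zero_mul]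
    · simp
  have hint : ∀ p : d × d, Integrable (fun g => A g p.1 p.1 * A g⁻¹ p.2 p.2) μ := fun p =>
    ((hA p.1 p.1).mul ((hA p.2 p.2).comp continuous_inv)).integrable_of_hasCompactSupport
      (HasCompactSupport.of_compactSpace _)
  rw [Finset.sum_congr rfl fun p _ => h2 p, ← integral_finsetSum _ fun p _ => hint p] at h1
  have h3 : ∀ g, ∑ p : d × d, A g p.1 p.1 * A g⁻¹ p.2 p.2 = ((‖(A g).trace‖ ^ 2 : ℝ) : ℂ) := by
    intro g
    rw [Fintype.sum_prod_type]
    simp_rw [← Finset.mul_sum]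
    rw [← Finset.sum_mul, hstar]
    push_cast
    rw [← Complex.mul_conj', Matrix.trace, map_sum]
    simp [Matrix.diag]
  simp_rw [h3] at h1
  rw [integral_complex_ofReal] at h1
  exact_mod_cast h1

end Averaging

/-! ### Strict growth of the commutant along an embedding. -/

section Lower

variable {G d₁ d₂ : Type*} [Fintype d₁] [DecidableEq d₁] [Fintype d₂] [DecidableEq d₂] [Group G]

/-- An injective, non-surjective intertwiner between unitary representations strictly increases
the dimension of the commutant. -/
theorem finrank_matrixCommutant_lt {A₁ : G →* Matrix d₁ d₁ ℂ} {A₂ : G →* Matrix d₂ d₂ ℂ}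
    (h₁ : ∀ g, A₁ g⁻¹ = (A₁ g).conjTranspose) (h₂ : ∀ g, A₂ g⁻¹ = (A₂ g).conjTranspose)
    (B : Matrix d₂ d₁ ℂ) (hB : ∀ g, A₂ g * B = B * A₁ g)
    (hinj : Function.Injective B.mulVec) (hcard : Fintype.card d₁ < Fintype.card d₂) :
    Module.finrank ℂ (matrixCommutant A₁) < Module.finrank ℂ (matrixCommutant A₂) := by
  -- By unitarity the adjoint of an intertwiner intertwines in the opposite direction, so `T ↦ B T
  -- B*` maps one commutant to the other.
  have hB' : ∀ g, B.conjTranspose * A₂ g = A₁ g * B.conjTranspose := fun g => by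
    have := congrArg Matrix.conjTranspose (hB g⁻¹)
    rw [Matrix.conjTranspose_mul, Matrix.conjTranspose_mul, h₁, h₂,
      Matrix.conjTranspose_conjTranspose, Matrix.conjTranspose_conjTranspose] at this
    exact this
  obtain ⟨R, hR⟩ : ∃ R : Matrix d₁ d₂ ℂ, R * B = 1 := by
    obtain ⟨r, hr⟩ := (Matrix.mulVecLin B).exists_leftInverse_of_injective
      (LinearMap.ker_eq_bot.2 hinj)
    refine ⟨LinearMap.toMatrix' r, Matrix.toLin'.injective ?_⟩
    rw [Matrix.toLin'_mul, Matrix.toLin'_toMatrix', Matrix.toLin'_one]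
    exact hr
  let φ : matrixCommutant A₁ →ₗ[ℂ] matrixCommutant A₂ :=
    { toFun := fun T => ⟨B * T.1 * B.conjTranspose, fun g => by
        rw [← Matrix.mul_assoc, ← Matrix.mul_assoc, hB, Matrix.mul_assoc B, T.2 g,
          Matrix.mul_assoc (B * T.1), hB']
        simp only [Matrix.mul_assoc]⟩
      map_add' := fun S T => by ext1; simp [Matrix.mul_add, Matrix.add_mul]
      map_smul' := fun c T => by ext1; simp }
  have hφ : Function.Injective φ := by
    intro S T h
    have h : B * S.1 * B.conjTranspose = B * T.1 * B.conjTranspose := congrArg Subtype.val h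
    have hR' : B.conjTranspose * R.conjTranspose = 1 := by
      rw [← Matrix.conjTranspose_mul, hR, Matrix.conjTranspose_one]
    have h' := congrArg (fun M => R * M * R.conjTranspose) h
    simp only [Matrix.mul_assoc, hR', Matrix.mul_one] at h'
    simp only [← Matrix.mul_assoc, hR, Matrix.one_mul] at h'
    exact Subtype.ext h'
  rw [← LinearMap.finrank_range_of_inj hφ]
  refine Submodule.finrank_lt fun htop => ?_
  -- The identity is missed: `B T B*` has rank at most `card d₁ < card d₂`.
  obtain ⟨T, hT⟩ := LinearMap.range_eq_top.1 htop ⟨1, fun g => by simp⟩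
  have hT : B * T.1 * B.conjTranspose = 1 := congrArg Subtype.val hT
  have hr := Matrix.rank_mul_le_left B (T.1 * B.conjTranspose)
  rw [← Matrix.mul_assoc, hT, Matrix.rank_one] at hr
  exact absurd (hr.trans (Matrix.rank_le_card_width B)) (by omega)

end Lower

/-! ### Compound matrices and secular coefficients. -/

section Compound

variable {ι I : Type*} [Fintype ι] [DecidableEq ι] [LinearOrder I] [Fintype I]

/-- The standard basis of `ℂ ^ ι`, indexed by a linearly ordered copy of `ι`. -/
noncomputable def reindexedBasis (e : ι ≃ I) : Module.Basis I ℂ (ι → ℂ) :=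
  (Pi.basisFun ℂ ι).reindex e

/-- The compound matrices: the matrices of the exterior powers. -/
noncomputable def compoundHom (e : ι ≃ I) (n : ℕ) :
    Matrix ι ι ℂ →* Matrix (Set.powersetCard I n) (Set.powersetCard I n) ℂ where
  toFun U := LinearMap.toMatrix ((reindexedBasis e).exteriorPower n)
    ((reindexedBasis e).exteriorPower n) (exteriorPower.map n (Matrix.toLin' U))
  map_one' := by rw [Matrix.toLin'_one, exteriorPower.map_id, LinearMap.toMatrix_id]
  map_mul' U V := by
    rw [Matrix.toLin'_mul, exteriorPower.map_comp, LinearMap.toMatrix_comp _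
      ((reindexedBasis e).exteriorPower n)]

lemma compoundHom_apply (e : ι ≃ I) (n : ℕ) (U : Matrix ι ι ℂ) (s t : Set.powersetCard I n) :
    compoundHom e n U s t = (U.submatrix (fun i => e.symm (Set.powersetCard.ofFinEmbEquiv.symm s i))
      (fun i => e.symm (Set.powersetCard.ofFinEmbEquiv.symm t i))).det := by
  rw [← Matrix.det_transpose]
  change LinearMap.toMatrix _ _ _ s t = _
  rw [LinearMap.toMatrix_apply, exteriorPower.basis_repr_apply, exteriorPower.basis_apply,
    exteriorPower.map_apply_ιMulti_family, exteriorPower.ιMulti_family,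
    exteriorPower.ιMultiDual_apply_ιMulti]
  congr 1
  ext i j
  simp [reindexedBasis]

lemma compoundHom_conjTranspose (e : ι ≃ I) (n : ℕ) (U : Matrix ι ι ℂ) :
    compoundHom e n U.conjTranspose = (compoundHom e n U).conjTranspose := by
  ext s t
  rw [Matrix.conjTranspose_apply, compoundHom_apply, compoundHom_apply, ← Matrix.det_conjTranspose,
    Matrix.conjTranspose_submatrix]

lemma continuous_compoundHom_apply (e : ι ≃ I) (n : ℕ) (s t : Set.powersetCard I n) :
    Continuous fun U : Matrix ι ι ℂ => compoundHom e n U s t := by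
  simp_rw [compoundHom_apply]
  exact (continuous_id.matrix_submatrix _ _).matrix_det

/-- The diagonal entries of the compound matrix are the principal minors, whose sum is the
coefficient of `x ^ n` in `det (1 + x U)`. -/
lemma trace_compoundHom (e : ι ≃ I) (n : ℕ) (U : Matrix ι ι ℂ) :
    (compoundHom e n U).trace = secularCoeff n U := by
  rw [secularCoeff, Matrix.coeff_det_one_add_X_smul_eq_sum_minors, Matrix.trace]
  refine Finset.sum_bij' (fun s _ => s.1.map e.symm.toEmbedding)
    (fun t ht => ⟨t.map e.toEmbedding, by
      simpa [Finset.mem_powersetCard] using ht⟩) ?_ ?_ ?_ ?_ ?_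
  · intro s _
    simp [Finset.mem_powersetCard]
  · simp
  · intro s _
    ext x
    simp
  · intro t _
    ext x
    simp
  · intro s _
    rw [Matrix.diag_apply, compoundHom_apply]
    let f : Fin n ≃ (s.1.map e.symm.toEmbedding : Finset ι) :=
      (s.1.orderIsoOfFin s.2).toEquiv.trans
        (e.symm.subtypeEquiv fun a => by simp)
    rw [← Matrix.det_submatrix_equiv_self f]
    rfl

end Compound

/-! ### The functional equation of the characteristic polynomial. -/

section Duality

open Polynomial in
/-- The secular coefficients of a unitary matrix satisfy a functional equation. -/
lemma norm_secularCoeff_sub {ι : Type*} [Fintype ι] [DecidableEq ι] {U : Matrix ι ι ℂ}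
    (hU : U ∈ Matrix.unitaryGroup ι ℂ) {n : ℕ} (hn : n ≤ Fintype.card ι) :
    ‖secularCoeff (Fintype.card ι - n) U‖ = ‖secularCoeff n U‖ := by
  have hstar : U * U.conjTranspose = 1 := Matrix.mem_unitaryGroup_iff.1 hU
  have hinv : (-U)⁻¹ = -U.conjTranspose := Matrix.inv_eq_right_inv (by simpa using hstar)
  have hu : IsUnit (-U) := IsUnit.of_mul_eq_one (-U.conjTranspose) (by simpa using hstar)
  have hrev : ∀ V : Matrix ι ι ℂ, ∀ j, secularCoeff j V = (-V).charpolyRev.coeff j := fun V j => by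
    rw [secularCoeff, Matrix.charpolyRev]
    congr 2
    refine Matrix.ext fun i k => ?_
    simp [sub_eq_add_neg]
  have hconj : secularCoeff n U.conjTranspose = star (secularCoeff n U) := by
    rw [← trace_compoundHom (Fintype.equivFin ι), ← trace_compoundHom (Fintype.equivFin ι),
      compoundHom_conjTranspose, Matrix.trace_conjTranspose]
  have hdet : ‖(-U).det‖ = 1 := by
    rw [Matrix.det_neg, norm_mul, norm_pow, norm_neg, norm_one, one_pow, one_mul]
    exact CStarRing.norm_of_mem_unitary (Matrix.det_of_mem_unitary hU)
  -- The characteristic polynomial of `(-U)⁻¹ = -U*` is the reversed one of `-U` up to a factor of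
  -- modulus one. Reversing once more relates degree `card ι - n` to `Sc_n(U*)`, the conjugate of
  -- `Sc_n(U)`.
  have h1 := Matrix.charpoly_inv (-U) hu
  rw [hinv, Ring.inverse_eq_inv, ← C_1, ← C_neg, ← C_pow, ← C_mul] at h1
  have h2 := congrArg (fun p => ‖p.coeff (Fintype.card ι - n)‖) h1
  simp only [coeff_C_mul, ← hrev, norm_mul, norm_pow, norm_neg, norm_one, one_pow, one_mul,
    norm_inv, hdet, inv_one] at h2
  have h3 : (-U.conjTranspose).charpoly.reverse.coeff n =
      (-U.conjTranspose).charpoly.coeff (Fintype.card ι - n) := by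
    rw [coeff_reverse, Matrix.charpoly_natDegree_eq_dim, revAt_le hn]
  rw [← h2, ← h3, Matrix.reverse_charpoly, ← hrev, hconj, norm_star]

end Duality

/-! ### Creation and annihilation operators on the exterior algebra. -/

section ExteriorOperators

variable {κ : Type*}

/-- The operator of contraction with the `x`-th coordinate form. -/
noncomputable def annihilate (x : κ) :
    ExteriorAlgebra ℂ (κ → ℂ) →ₗ[ℂ] ExteriorAlgebra ℂ (κ → ℂ) :=
  CliffordAlgebra.contractLeft (Q := 0) (LinearMap.proj x)

/-- The `x`-th standard basis vector, in the exterior algebra. -/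
noncomputable def extVec [DecidableEq κ] (x : κ) : ExteriorAlgebra ℂ (κ → ℂ) :=
  ExteriorAlgebra.ι ℂ (Pi.single x 1)

lemma annihilate_ι_mul (x : κ) (v : κ → ℂ) (y : ExteriorAlgebra ℂ (κ → ℂ)) :
    annihilate x (ExteriorAlgebra.ι ℂ v * y) =
      v x • y - ExteriorAlgebra.ι ℂ v * annihilate x y :=
  CliffordAlgebra.contractLeft_ι_mul _ _ _

lemma annihilate_extVec_mul [DecidableEq κ] (x z : κ) (y : ExteriorAlgebra ℂ (κ → ℂ)) :
    annihilate x (extVec z * y) = (if x = z then y else 0) - extVec z * annihilate x y := by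
  rw [extVec, annihilate_ι_mul, Pi.single_apply]
  split_ifs <;> simp

lemma ι_eq_sum_extVec [Fintype κ] [DecidableEq κ] (v : κ → ℂ) : ExteriorAlgebra.ι ℂ v = ∑ x, v x • extVec x := by
  conv_lhs => rw [pi_eq_sum_univ' v, map_sum]
  simp only [map_smul, extVec, Pi.single]

/-- The number operator multiplies the `p`-th exterior power by `p`. -/
lemma sum_extVec_mul_annihilate [Fintype κ] [DecidableEq κ] {p : ℕ} {y : ExteriorAlgebra ℂ (κ → ℂ)}
    (hy : y ∈ ⋀[ℂ]^p (κ → ℂ)) : ∑ x, extVec x * annihilate x y = (p : ℂ) • y := by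
  have key : ∀ (p : ℕ) (v : Fin p → κ → ℂ),
      ∑ x, extVec x * annihilate x (ExteriorAlgebra.ιMulti ℂ p v) =
        (p : ℂ) • ExteriorAlgebra.ιMulti ℂ p v := by
    intro p
    induction p with
    | zero =>
      intro v
      have : ∀ x : κ, annihilate x (1 : ExteriorAlgebra ℂ (κ → ℂ)) = 0 := fun x =>
        CliffordAlgebra.contractLeft_one (Q := 0) _
      simp [this]
    | succ p ih =>
      intro v
      have hanti : ∀ x : κ, extVec x * ExteriorAlgebra.ι ℂ (v 0) =
          -(ExteriorAlgebra.ι ℂ (v 0) * extVec x) := fun x =>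
        eq_neg_of_add_eq_zero_left (ExteriorAlgebra.ι_add_mul_swap _ _)
      rw [ExteriorAlgebra.ιMulti_succ_apply]
      simp only [annihilate_ι_mul, mul_sub, Finset.sum_sub_distrib, ← mul_assoc, hanti, neg_mul,
        Finset.sum_neg_distrib, mul_smul_comm, ← smul_mul_assoc]
      rw [← Finset.sum_mul, ← ι_eq_sum_extVec]
      simp only [mul_assoc]
      rw [← Finset.mul_sum, ih, mul_smul_comm]
      push_cast
      rw [smul_mul_assoc]
      module
  rw [← exteriorPower.ιMulti_span_fixedDegree] at hy
  induction hy using Submodule.span_induction with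
  | mem y hy => obtain ⟨v, rfl⟩ := hy; exact key p v
  | zero => simp
  | add y z _ _ hy hz => simp only [map_add, mul_add, Finset.sum_add_distrib, hy, hz, smul_add]
  | smul c y _ hy =>
    simp only [map_smul, mul_smul_comm, ← Finset.smul_sum, hy, smul_comm c]

lemma annihilate_eq_zero {y : ExteriorAlgebra ℂ (κ → ℂ)}
    (hy : y ∈ ⋀[ℂ]^0 (κ → ℂ)) (x : κ) : annihilate x y = 0 := by
  rw [ExteriorAlgebra.exteriorPower, pow_zero] at hy
  obtain ⟨r, rfl⟩ := Submodule.mem_one.1 hy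
  exact CliffordAlgebra.contractLeft_algebraMap _ _ _

lemma annihilate_mem {p : ℕ} {y : ExteriorAlgebra ℂ (κ → ℂ)}
    (hy : y ∈ ⋀[ℂ]^(p + 1) (κ → ℂ)) (x : κ) : annihilate x y ∈ ⋀[ℂ]^p (κ → ℂ) := by
  have key : ∀ (p : ℕ) (v : Fin (p + 1) → κ → ℂ),
      annihilate x (ExteriorAlgebra.ιMulti ℂ (p + 1) v) ∈ ⋀[ℂ]^p (κ → ℂ) := by
    intro p
    induction p with
    | zero =>
      intro v
      rw [ExteriorAlgebra.ιMulti_succ_apply, annihilate_ι_mul, annihilate_eq_zero, mul_zero,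
        sub_zero]
      · exact Submodule.smul_mem _ _ (ExteriorAlgebra.ιMulti_range ℂ 0 ⟨_, rfl⟩)
      · exact ExteriorAlgebra.ιMulti_range ℂ 0 ⟨_, rfl⟩
    | succ p ih =>
      intro v
      rw [ExteriorAlgebra.ιMulti_succ_apply, annihilate_ι_mul]
      refine Submodule.sub_mem _ (Submodule.smul_mem _ _
        (ExteriorAlgebra.ιMulti_range ℂ _ ⟨_, rfl⟩)) ?_
      rw [ExteriorAlgebra.exteriorPower, pow_succ']
      exact Submodule.mul_mem_mul ⟨_, rfl⟩ (ih _)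
  rw [← exteriorPower.ιMulti_span_fixedDegree] at hy
  induction hy using Submodule.span_induction with
  | mem y hy => obtain ⟨v, rfl⟩ := hy; exact key p v
  | zero => simp
  | add y z _ _ hy hz => rw [map_add]; exact Submodule.add_mem _ hy hz
  | smul c y _ hy => rw [map_smul]; exact Submodule.smul_mem _ _ hy

end ExteriorOperators

/-! ### The Lefschetz operator and its injectivity below the middle degree. -/

section Lefschetz

variable (N : ℕ)

/-- The symplectic bivector `∑ eᵢ ∧ fᵢ`. -/
noncomputable def pairSum : ExteriorAlgebra ℂ (Fin N ⊕ Fin N → ℂ) :=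
  ∑ i : Fin N, extVec (Sum.inl i) * extVec (Sum.inr i)

/-- The contraction with the symplectic form. -/
noncomputable def dualLefschetz :
    ExteriorAlgebra ℂ (Fin N ⊕ Fin N → ℂ) →ₗ[ℂ] ExteriorAlgebra ℂ (Fin N ⊕ Fin N → ℂ) :=
  ∑ i : Fin N, annihilate (Sum.inr i) ∘ₗ annihilate (Sum.inl i)

variable {N}

/-- This is the `sl₂` relation. Only equal indices contribute to the commutator, each giving `1`
minus the occupation numbers of its two vectors. Summed over the planes, this is `N` minus the
number operator. -/
lemma dualLefschetz_pairSum_mul {p : ℕ} {y : ExteriorAlgebra ℂ (Fin N ⊕ Fin N → ℂ)}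
    (hy : y ∈ ⋀[ℂ]^p (Fin N ⊕ Fin N → ℂ)) :
    dualLefschetz N (pairSum N * y) =
      pairSum N * dualLefschetz N y + ((N : ℂ) - p) • y := by
  have h1 : ∀ i j : Fin N, annihilate (Sum.inr i) (annihilate (Sum.inl i)
      (extVec (Sum.inl j) * extVec (Sum.inr j) * y)) =
      (if i = j then y - extVec (Sum.inl i) * annihilate (Sum.inl i) y -
        extVec (Sum.inr i) * annihilate (Sum.inr i) y else 0) +
      extVec (Sum.inl j) * extVec (Sum.inr j) *
        annihilate (Sum.inr i) (annihilate (Sum.inl i) y) := by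
    intro i j
    by_cases h : i = j
    · subst h
      simp only [mul_assoc, annihilate_extVec_mul, map_add, mul_sub, if_true, reduceCtorEq,
        if_false, zero_sub, sub_neg_eq_add, mul_neg]
      abel
    · simp [mul_assoc, annihilate_extVec_mul, h]
  have h2 := sum_extVec_mul_annihilate hy
  rw [Fintype.sum_sum_type] at h2
  simp only [dualLefschetz, pairSum, LinearMap.sum_apply, LinearMap.comp_apply, Finset.sum_mul,
    map_sum, h1, Finset.sum_add_distrib, Finset.sum_ite_eq', Finset.mem_univ, if_true, sub_smul,
    ← h2, Finset.mul_sum]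
  simp only [Finset.sum_sub_distrib, Finset.sum_const, Finset.card_univ, Fintype.card_fin,
    Nat.cast_smul_eq_nsmul]
  rw [Finset.sum_comm]
  abel

lemma dualLefschetz_eq_zero {p : ℕ} (hp : p < 2) {y : ExteriorAlgebra ℂ (Fin N ⊕ Fin N → ℂ)}
    (hy : y ∈ ⋀[ℂ]^p (Fin N ⊕ Fin N → ℂ)) : dualLefschetz N y = 0 := by
  simp only [dualLefschetz, LinearMap.sum_apply, LinearMap.comp_apply]
  refine Finset.sum_eq_zero fun i _ => ?_
  interval_cases p
  · rw [annihilate_eq_zero hy, map_zero]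
  · exact annihilate_eq_zero (annihilate_mem hy _) _

lemma dualLefschetz_mem {p : ℕ} {y : ExteriorAlgebra ℂ (Fin N ⊕ Fin N → ℂ)}
    (hy : y ∈ ⋀[ℂ]^(p + 2) (Fin N ⊕ Fin N → ℂ)) :
    dualLefschetz N y ∈ ⋀[ℂ]^p (Fin N ⊕ Fin N → ℂ) := by
  simp only [dualLefschetz, LinearMap.sum_apply, LinearMap.comp_apply]
  exact Submodule.sum_mem _ fun i _ => annihilate_mem (annihilate_mem hy _) _

/-- Below the middle degree, contraction after wedging has no nonpositive eigenvalue. -/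
lemma eq_zero_of_dualLefschetz_pairSum_mul (p : ℕ) (hp : p < N)
    {y : ExteriorAlgebra ℂ (Fin N ⊕ Fin N → ℂ)} (hy : y ∈ ⋀[ℂ]^p (Fin N ⊕ Fin N → ℂ))
    (c : ℕ) (h : dualLefschetz N (pairSum N * y) = -((c : ℂ) • y)) : y = 0 := by
  induction p using Nat.strong_induction_on generalizing y c with
  | _ p ih =>
    rw [dualLefschetz_pairSum_mul hy] at h
    -- Contracting this identity gives the same hypothesis for `dualLefschetz N y`, two degrees
    -- lower and with the larger constant `c + (N - p)`; this is why `c` is arbitrary. Once the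
    -- contraction vanishes, the positive factor `c + (N - p)` forces `y = 0`.
    have h' : pairSum N * dualLefschetz N y = -(((c + (N - p) : ℕ) : ℂ) • y) := by
      rw [← eq_sub_iff_add_eq] at h
      rw [h, Nat.cast_add, Nat.cast_sub hp.le]
      module
    have hz : dualLefschetz N y = 0 := by
      rcases lt_or_ge p 2 with h2 | h2
      · exact dualLefschetz_eq_zero h2 hy
      · obtain ⟨q, rfl⟩ := Nat.exists_eq_add_of_le' h2
        refine ih q (by omega) (by omega) (dualLefschetz_mem hy) (c + (N - (q + 2))) ?_
        rw [h', map_neg, map_smul]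
    rw [hz, mul_zero, eq_comm, neg_eq_zero, smul_eq_zero] at h'
    exact h'.resolve_left (Nat.cast_ne_zero.2 (by omega))

/-- The symplectic bivector, written with the matrix `J`. -/
lemma sum_J_extVec_mul :
    ∑ x, ∑ y, Matrix.J (Fin N) ℂ x y • (extVec x * extVec y) = -((2 : ℂ) • pairSum N) := by
  have hanti : ∀ x y : Fin N ⊕ Fin N, extVec x * extVec y = -(extVec y * extVec x) := fun x y =>
    eq_neg_of_add_eq_zero_left (ExteriorAlgebra.ι_add_mul_swap _ _)
  simp only [Fintype.sum_sum_type, Matrix.J, Matrix.fromBlocks_apply₁₁, Matrix.fromBlocks_apply₁₂,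
    Matrix.fromBlocks_apply₂₁, Matrix.fromBlocks_apply₂₂, Matrix.zero_apply, zero_smul,
    Finset.sum_const_zero, zero_add, add_zero, Matrix.neg_apply, Matrix.one_apply, neg_smul,
    ite_smul, one_smul, Finset.sum_neg_distrib, Finset.sum_ite_eq, Finset.mem_univ, if_true]
  rw [Finset.sum_congr rfl fun i _ => hanti (Sum.inr i) (Sum.inl i), Finset.sum_neg_distrib,
    pairSum]
  module

/-- The bivector is, up to the factor `-2`, `∑ J_xy e_x ∧ e_y`, and applying `U` to the vectors
replaces `J` by `U J Uᵀ`. -/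
lemma map_pairSum {U : Matrix (Fin N ⊕ Fin N) (Fin N ⊕ Fin N) ℂ}
    (hU : U ∈ Matrix.symplecticGroup (Fin N) ℂ) :
    ExteriorAlgebra.map (Matrix.toLin' U) (pairSum N) = pairSum N := by
  have hvec : ∀ x, ExteriorAlgebra.map (Matrix.toLin' U) (extVec x) = ∑ z, U z x • extVec z := by
    intro x
    rw [extVec, ExteriorAlgebra.map_apply_ι, ι_eq_sum_extVec]
    simp
  have h2 : ExteriorAlgebra.map (Matrix.toLin' U)
      (∑ x, ∑ y, Matrix.J (Fin N) ℂ x y • (extVec x * extVec y)) =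
      ∑ x, ∑ y, Matrix.J (Fin N) ℂ x y • (extVec x * extVec y) := by
    conv_rhs => rw [← SymplecticGroup.mem_iff.1 hU]
    simp only [map_sum, map_smul, map_mul, hvec, Matrix.mul_apply, Matrix.transpose_apply,
      Finset.sum_mul, Finset.mul_sum, Finset.smul_sum, Finset.sum_smul, smul_mul_smul_comm,
      smul_smul]
    have hflat : ∀ F : (Fin N ⊕ Fin N) → (Fin N ⊕ Fin N) → (Fin N ⊕ Fin N) → (Fin N ⊕ Fin N) →
        ExteriorAlgebra ℂ (Fin N ⊕ Fin N → ℂ), ∑ x, ∑ y, ∑ z, ∑ w, F x y z w =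
        ∑ z, ∑ w, ∑ x, ∑ y, F x y z w := fun F => by
      have h3 : ∀ x, ∑ y, ∑ z, ∑ w, F x y z w = ∑ z, ∑ w, ∑ y, F x y z w := fun x => by
        rw [Finset.sum_comm]
        exact Finset.sum_congr rfl fun z _ => Finset.sum_comm
      rw [Finset.sum_congr rfl fun x _ => h3 x, Finset.sum_comm]
      exact Finset.sum_congr rfl fun z _ => Finset.sum_comm
    rw [hflat, Finset.sum_comm]
    refine Finset.sum_congr rfl fun a _ => Finset.sum_congr rfl fun b _ => ?_
    rw [Finset.sum_comm]
    refine Finset.sum_congr rfl fun c _ => Finset.sum_congr rfl fun i _ => ?_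
    congr 1
    ring
  rw [sum_J_extVec_mul, map_neg, map_smul, neg_inj] at h2
  exact smul_right_injective _ two_ne_zero h2

lemma coe_exteriorPower_map {M : Type*} [AddCommGroup M] [Module ℂ M] (n : ℕ) (f : M →ₗ[ℂ] M)
    (y : ⋀[ℂ]^n M) :
    (exteriorPower.map n f y : ExteriorAlgebra ℂ M) = ExteriorAlgebra.map f y := by
  have : (⋀[ℂ]^n M).subtype ∘ₗ exteriorPower.map n f =
      (ExteriorAlgebra.map f).toLinearMap ∘ₗ (⋀[ℂ]^n M).subtype := by
    refine exteriorPower.linearMap_ext ?_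
    ext v
    simp [ExteriorAlgebra.map_apply_ιMulti]
  exact LinearMap.congr_fun this y

lemma pairSum_mul_mem {n : ℕ} {y : ExteriorAlgebra ℂ (Fin N ⊕ Fin N → ℂ)}
    (hy : y ∈ ⋀[ℂ]^n (Fin N ⊕ Fin N → ℂ)) :
    pairSum N * y ∈ ⋀[ℂ]^(n + 2) (Fin N ⊕ Fin N → ℂ) := by
  rw [ExteriorAlgebra.exteriorPower, add_comm, pow_add]
  refine Submodule.mul_mem_mul (Submodule.sum_mem _ fun i _ => ?_) hy
  rw [pow_two]
  exact Submodule.mul_mem_mul ⟨_, rfl⟩ ⟨_, rfl⟩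

/-- The Lefschetz operator: the exterior product with the symplectic bivector. -/
noncomputable def lefschetz (N n : ℕ) :
    ⋀[ℂ]^n (Fin N ⊕ Fin N → ℂ) →ₗ[ℂ] ⋀[ℂ]^(n + 2) (Fin N ⊕ Fin N → ℂ) :=
  (LinearMap.mulLeft ℂ (pairSum N)).restrict fun _ => pairSum_mul_mem

lemma lefschetz_injective {n : ℕ} (hn : n < N) : Function.Injective (lefschetz N n) := by
  rw [← LinearMap.ker_eq_bot, LinearMap.ker_eq_bot']
  intro y hy
  have hy' : pairSum N * (y : ExteriorAlgebra ℂ (Fin N ⊕ Fin N → ℂ)) = 0 :=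
    congrArg Subtype.val hy
  exact Subtype.ext (eq_zero_of_dualLefschetz_pairSum_mul n hn y.2 0 (by simp [hy']))

lemma map_lefschetz {U : Matrix (Fin N ⊕ Fin N) (Fin N ⊕ Fin N) ℂ}
    (hU : U ∈ Matrix.symplecticGroup (Fin N) ℂ) (n : ℕ) :
    exteriorPower.map (n + 2) (Matrix.toLin' U) ∘ₗ lefschetz N n =
      lefschetz N n ∘ₗ exteriorPower.map n (Matrix.toLin' U) := by
  refine LinearMap.ext fun y => Subtype.ext ?_
  simp only [LinearMap.comp_apply, coe_exteriorPower_map]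
  change ExteriorAlgebra.map _ (pairSum N * _) = pairSum N * (exteriorPower.map n _ y).1
  rw [map_mul, map_pairSum hU, coe_exteriorPower_map]
  rfl

end Lefschetz

/-! ### The exterior representation and the lower bound. -/

section LowerBound

/-- The representation of `Sp(2N)` on the `n`-th exterior power, in matrix form. -/
noncomputable def exteriorRep (N n : ℕ) :
    unitarySymplectic N →* Matrix (Set.powersetCard (Fin N ⊕ₗ Fin N) n)
      (Set.powersetCard (Fin N ⊕ₗ Fin N) n) ℂ where
  toFun U := compoundHom toLex n U.1.1
  map_one' := map_one _
  map_mul' U V := map_mul (compoundHom toLex n) U.1.1 V.1.1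

lemma exteriorRep_inv (N n : ℕ) (U : unitarySymplectic N) :
    exteriorRep N n U⁻¹ = (exteriorRep N n U).conjTranspose :=
  compoundHom_conjTranspose toLex n U.1.1

lemma continuous_exteriorRep (N n : ℕ) (s t : Set.powersetCard (Fin N ⊕ₗ Fin N) n) :
    Continuous fun U => exteriorRep N n U s t :=
  (continuous_compoundHom_apply toLex n s t).comp
    (continuous_subtype_val.comp continuous_subtype_val)

lemma integral_norm_secularCoeff_sq (n N : ℕ) :
    ∫ U : unitarySymplectic N, ‖secularCoeff n U.1.1‖ ^ 2 ∂(unitarySymplecticHaar N) =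
      Module.finrank ℂ (matrixCommutant (exteriorRep N n)) := by
  rw [← integral_norm_trace_sq (unitarySymplecticHaar N) (continuous_exteriorRep N n)
    (exteriorRep_inv N n)]
  refine integral_congr_ae (ae_of_all _ fun U => ?_)
  change _ = ‖(compoundHom toLex n U.1.1).trace‖ ^ 2
  rw [trace_compoundHom]

lemma card_powersetCard_lex (N n : ℕ) :
    Fintype.card (Set.powersetCard (Fin N ⊕ₗ Fin N) n) = (2 * N).choose n := by
  rw [Fintype.card_eq_nat_card, Set.powersetCard.card]
  simp [Lex, two_mul]

lemma choose_lt_choose_succ {n k : ℕ} (h : 2 * k + 1 < n) : n.choose k < n.choose (k + 1) := by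
  have h1 := Nat.choose_succ_right_eq n k
  have h2 : 0 < n.choose k := Nat.choose_pos (by omega)
  by_contra hle
  have h3 : n.choose (k + 1) * (k + 1) ≤ n.choose k * (k + 1) :=
    Nat.mul_le_mul_right _ (not_lt.1 hle)
  have h4 : n.choose k * (k + 1) < n.choose k * (n - k) :=
    Nat.mul_lt_mul_of_pos_left (by omega) h2
  omega

theorem le_finrank_matrixCommutant (n N : ℕ) (hn : n ≤ N) :
    n / 2 + 1 ≤ Module.finrank ℂ (matrixCommutant (exteriorRep N n)) := by
  induction n using Nat.strong_induction_on with
  | _ n ih =>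
    rcases lt_or_ge n 2 with h2 | h2
    -- In degrees `0` and `1` the bound is `1`, and the scalars suffice because the exterior power
    -- is nonzero.
    · have : Nontrivial (matrixCommutant (exteriorRep N n)) := by
        have : Nonempty (Set.powersetCard (Fin N ⊕ₗ Fin N) n) := by
          rw [← Fintype.card_pos_iff, card_powersetCard_lex]
          exact Nat.choose_pos (by omega)
        refine ⟨⟨⟨1, fun g => by simp⟩, 0, fun h => ?_⟩⟩
        exact one_ne_zero (congrArg Subtype.val h)
      have := Module.finrank_pos (R := ℂ) (M := matrixCommutant (exteriorRep N n))
      omega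
    · obtain ⟨m, rfl⟩ := Nat.exists_eq_add_of_le' h2
      have h1 := ih m (by omega) (by omega)
      let b := fun k => (reindexedBasis (toLex : Fin N ⊕ Fin N ≃ Fin N ⊕ₗ Fin N)).exteriorPower k
      have := finrank_matrixCommutant_lt (exteriorRep_inv N m) (exteriorRep_inv N (m + 2))
        (LinearMap.toMatrix (b m) (b (m + 2)) (lefschetz N m))
        (fun U => by
          change LinearMap.toMatrix (b _) (b _) _ * _ = _ * LinearMap.toMatrix (b _) (b _) _
          rw [← LinearMap.toMatrix_comp, ← LinearMap.toMatrix_comp, map_lefschetz U.2])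
        (fun x y h => by
          have := lefschetz_injective (show m < N by omega)
          have hrepr : ∀ x, (LinearMap.toMatrix (b m) (b (m + 2)) (lefschetz N m)).mulVec x =
              (b (m + 2)).equivFun (lefschetz N m ((b m).equivFun.symm x)) := fun x => by
            have := LinearMap.toMatrix_mulVec_repr (b m) (b (m + 2)) (lefschetz N m)
              ((b m).equivFun.symm x)
            rw [← Module.Basis.equivFun_apply, LinearEquiv.apply_symm_apply] at this
            exact this
          simp only [hrepr] at h
          exact (b m).equivFun.symm.injective (this ((b (m + 2)).equivFun.injective h)))
        (by
          rw [card_powersetCard_lex, card_powersetCard_lex]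
          exact (choose_lt_choose_succ (by omega)).trans
            (choose_lt_choose_succ (by omega)))
      omega

end LowerBound

/-! ### Wedges of basis vectors, Plücker coordinates, monomial matrices. -/

section Wedge

variable {κ : Type*} {n : ℕ}

/-- The exterior product of the standard basis vectors listed by a tuple. -/
noncomputable def wedge [DecidableEq κ] (a : Fin n → κ) : ⋀[ℂ]^n (κ → ℂ) :=
  exteriorPower.ιMulti ℂ n fun i => Pi.single (a i) 1

/-- The Plücker coordinate listed by a tuple. -/
noncomputable def wedgeCoord (a : Fin n → κ) : ⋀[ℂ]^n (κ → ℂ) →ₗ[ℂ] ℂ :=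
  exteriorPower.pairingDual ℂ (κ → ℂ) n
    (exteriorPower.ιMulti ℂ n fun i => LinearMap.proj (a i))

lemma wedge_comp_perm [DecidableEq κ] (a : Fin n → κ) (π : Equiv.Perm (Fin n)) :
    wedge (a ∘ π) = Equiv.Perm.sign π • wedge a :=
  (exteriorPower.ιMulti ℂ n).map_perm (fun i => Pi.single (a i) 1) π

lemma wedgeCoord_comp_perm (a : Fin n → κ) (π : Equiv.Perm (Fin n)) :
    wedgeCoord (a ∘ π) = Equiv.Perm.sign π • wedgeCoord a := by
  have := (exteriorPower.ιMulti ℂ n).map_perm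
    (fun i => (LinearMap.proj (a i) : (κ → ℂ) →ₗ[ℂ] ℂ)) π
  unfold wedgeCoord
  rw [← LinearMap.map_smul_of_tower, ← this]
  rfl

lemma wedge_eq_zero [DecidableEq κ] {a : Fin n → κ} (ha : ¬ Function.Injective a) : wedge a = 0 :=
  (exteriorPower.ιMulti ℂ n).map_eq_zero_of_not_injective _ fun h => ha fun i j hij =>
    h (by simp [hij])

lemma wedgeCoord_eq_zero {a : Fin n → κ} (ha : ¬ Function.Injective a) : wedgeCoord a = 0 := by
  unfold wedgeCoord
  rw [(exteriorPower.ιMulti ℂ n).map_eq_zero_of_not_injective _ fun h => ha fun i j hij =>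
    h (by simp [hij]), map_zero]

lemma exists_perm_of_image_eq [DecidableEq κ] {a a' : Fin n → κ} (ha : Function.Injective a)
    (ha' : Function.Injective a') (h : Finset.univ.image a = Finset.univ.image a') :
    ∃ π : Equiv.Perm (Fin n), a' = a ∘ π := by
  have hr : Set.range a' = Set.range a := by
    simpa using (congrArg (fun s : Finset κ => (s : Set κ)) h).symm
  refine ⟨((Equiv.ofInjective a' ha').trans (Equiv.setCongr hr)).trans
    (Equiv.ofInjective a ha).symm, ?_⟩
  ext1 i
  simp [Equiv.apply_ofInjective_symm]

variable [Fintype κ]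

/-- The coordinates listed by increasing tuples, for any linear order on `κ`, already form the dual
basis. -/
lemma eq_zero_of_wedgeCoord {w : ⋀[ℂ]^n (κ → ℂ)} (hw : ∀ a : Fin n → κ, wedgeCoord a w = 0) :
    w = 0 := by
  classical
  let e := Fintype.equivFin κ
  refine ((reindexedBasis e).exteriorPower n).repr.injective ?_
  ext s
  rw [exteriorPower.basis_repr_apply, map_zero, Finsupp.zero_apply, ← hw
    (fun i => e.symm (Set.powersetCard.ofFinEmbEquiv.symm s i))]
  unfold exteriorPower.ιMultiDual exteriorPower.ιMulti_family wedgeCoord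
  congr 3

variable [DecidableEq κ]

lemma span_range_wedge : Submodule.span ℂ (Set.range (wedge : (Fin n → κ) → _)) = ⊤ := by
  rw [eq_top_iff, ← exteriorPower.ιMulti_span_of_span ℂ n (M := κ → ℂ)
    (s := Set.range fun x => Pi.single x (1 : ℂ)) (by
      rw [← (Pi.basisFun ℂ κ).span_eq]
      congr 2
      ext1 x
      exact (Pi.basisFun_apply ℂ κ x).symm)]
  refine Submodule.span_mono ?_
  rintro _ ⟨v, hv, rfl⟩
  choose a ha using fun i => hv (Set.mem_range_self i)
  exact ⟨a, by simp only [wedge, ha]⟩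

/-- The matrix sending the basis vector at `x` to `c x` times the basis vector at `τ x`. -/
def monomialMatrix (τ : Equiv.Perm κ) (c : κ → ℂ) : Matrix κ κ ℂ :=
  Matrix.of fun y x => if y = τ x then c x else 0

lemma map_monomialMatrix_wedge (τ : Equiv.Perm κ) (c : κ → ℂ) (a : Fin n → κ) :
    exteriorPower.map n (Matrix.toLin' (monomialMatrix τ c)) (wedge a) =
      (∏ i, c (a i)) • wedge (τ ∘ a) := by
  rw [wedge, exteriorPower.map_apply_ιMulti, wedge, ← AlternatingMap.map_smul_univ]
  congr 1
  ext i y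
  simp [monomialMatrix, Pi.single_apply]

lemma wedgeCoord_map_monomialMatrix (τ : Equiv.Perm κ) (c : κ → ℂ) (a : Fin n → κ)
    (w : ⋀[ℂ]^n (κ → ℂ)) :
    wedgeCoord (τ ∘ a) (exteriorPower.map n (Matrix.toLin' (monomialMatrix τ c)) w) =
      (∏ i, c (a i)) * wedgeCoord a w := by
  have : wedgeCoord (τ ∘ a) ∘ₗ exteriorPower.map n (Matrix.toLin' (monomialMatrix τ c)) =
      (∏ i, c (a i)) • wedgeCoord a := by
    refine exteriorPower.linearMap_ext ?_
    ext v
    have h := AlternatingMap.map_smul_univ (exteriorPower.ιMulti ℂ n) (fun i => c (a i))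
      (fun i => (LinearMap.proj (a i) : (κ → ℂ) →ₗ[ℂ] ℂ))
    have h' := congrArg (fun z => exteriorPower.pairingDual ℂ (κ → ℂ) n z
      (exteriorPower.ιMulti ℂ n v)) h
    simp only [map_smul, LinearMap.smul_apply] at h'
    simp only [LinearMap.compAlternatingMap_apply, LinearMap.comp_apply, LinearMap.smul_apply,
      exteriorPower.map_apply_ιMulti]
    rw [wedgeCoord, wedgeCoord, ← h', exteriorPower.pairingDual_ιMulti_ιMulti,
      exteriorPower.pairingDual_ιMulti_ιMulti]
    congr 1
    ext i j
    simp [monomialMatrix, Matrix.mulVec, dotProduct]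
  exact LinearMap.congr_fun this w

end Wedge

/-! ### Explicit elements of `Sp(2N)`: torus, permutations, flips, rotations. -/

section SymplecticElements

variable {N : ℕ}

lemma exists_unitarySymplectic {U : Matrix (Fin N ⊕ Fin N) (Fin N ⊕ Fin N) ℂ}
    (h : U * U.conjTranspose = 1) (hJ : U * Matrix.J (Fin N) ℂ * U.transpose = Matrix.J (Fin N) ℂ) :
    ∃ g : unitarySymplectic N, g.1.1 = U :=
  ⟨⟨⟨U, Matrix.mem_unitaryGroup_iff.2 h⟩, SymplecticGroup.mem_iff.2 hJ⟩, rfl⟩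

lemma exists_eq_monomialMatrix (τ : Equiv.Perm (Fin N ⊕ Fin N)) (c : Fin N ⊕ Fin N → ℂ)
    (hc : ∀ x, c x * star (c x) = 1)
    (hJ : ∀ x y, c x * c y * Matrix.J (Fin N) ℂ x y = Matrix.J (Fin N) ℂ (τ x) (τ y)) :
    ∃ g : unitarySymplectic N, g.1.1 = monomialMatrix τ c := by
  refine exists_unitarySymplectic ?_ ?_
  · refine Matrix.ext fun y z => ?_
    obtain ⟨y, rfl⟩ := τ.surjective y
    obtain ⟨z, rfl⟩ := τ.surjective z
    rw [Matrix.mul_apply, Finset.sum_eq_single y]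
    · by_cases h : y = z
      · subst h; simp [monomialMatrix, ← hc y]
      · simp [monomialMatrix, h, Ne.symm h]
    · intro x _ hx
      simp [monomialMatrix, Ne.symm hx]
    · simp
  · refine Matrix.ext fun y z => ?_
    obtain ⟨y, rfl⟩ := τ.surjective y
    obtain ⟨z, rfl⟩ := τ.surjective z
    rw [Matrix.mul_apply, Finset.sum_eq_single z, Matrix.mul_apply, Finset.sum_eq_single y]
    · simp only [monomialMatrix, Matrix.of_apply, if_true, Matrix.transpose_apply]
      rw [← hJ]
      ring
    · intro x _ hx
      simp [monomialMatrix, Ne.symm hx]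
    · simp
    · intro x _ hx
      simp [monomialMatrix, Ne.symm hx]
    · simp

/-- The eigenvalues of the torus element acting by `i` and `-i` on the hyperbolic plane at `s`. -/
noncomputable def torusWeight (s : Fin N) : Fin N ⊕ Fin N → ℂ :=
  Sum.elim (fun x => if x = s then Complex.I else 1) (fun x => if x = s then -Complex.I else 1)

lemma exists_torus (s : Fin N) :
    ∃ g : unitarySymplectic N, g.1.1 = monomialMatrix (Equiv.refl _) (torusWeight s) := by
  refine exists_eq_monomialMatrix _ _ ?_ ?_
  · rintro (x | x) <;> by_cases h : x = s <;> simp [torusWeight, h]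
  · rintro (x | x) (y | y) <;> by_cases h : x = s <;> by_cases h' : y = s <;>
      simp [torusWeight, h, h', Matrix.J, Matrix.one_apply] <;> simp [Ne.symm h']

lemma exists_permutation (σ : Equiv.Perm (Fin N)) :
    ∃ g : unitarySymplectic N, g.1.1 = monomialMatrix (Equiv.sumCongr σ σ) 1 := by
  refine exists_eq_monomialMatrix _ _ (by simp) ?_
  rintro (x | x) (y | y) <;> simp [Matrix.J, Matrix.one_apply]

/-- The exchange of the two isotropic lines at `s`. -/
def siteFlip (s : Fin N) : Equiv.Perm (Fin N ⊕ Fin N) := Equiv.swap (Sum.inl s) (Sum.inr s)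

lemma siteFlip_inl (s x : Fin N) :
    siteFlip s (Sum.inl x) = if x = s then Sum.inr x else Sum.inl x := by
  split_ifs with h
  · subst h; simp [siteFlip]
  · exact Equiv.swap_apply_of_ne_of_ne (by simpa using h) (by simp)

lemma siteFlip_inr (s x : Fin N) :
    siteFlip s (Sum.inr x) = if x = s then Sum.inl x else Sum.inr x := by
  split_ifs with h
  · subst h; simp [siteFlip]
  · exact Equiv.swap_apply_of_ne_of_ne (by simp) (by simpa using h)

lemma exists_siteFlip (s : Fin N) :
    ∃ g : unitarySymplectic N, ∃ c : Fin N ⊕ Fin N → ℂ, (∀ x, c x ≠ 0) ∧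
      g.1.1 = monomialMatrix (siteFlip s) c := by
  -- The bare exchange reverses the sign of the form on the plane at `s`; one sign restores it.
  let c : Fin N ⊕ Fin N → ℂ := fun z => if z = Sum.inl s then -1 else 1
  have hc : ∀ x, c x = 1 ∨ c x = -1 := fun x => by
    by_cases h : x = Sum.inl s <;> simp [c, h]
  obtain ⟨g, hg⟩ := exists_eq_monomialMatrix (siteFlip s) c
    (fun x => by rcases hc x with h | h <;> simp [h]) (by
      rintro (x | x) (y | y) <;> by_cases h : x = s <;> by_cases h' : y = s <;>
        simp [siteFlip_inl, siteFlip_inr, c, h, h', Matrix.J, Matrix.one_apply] <;> exact Ne.symm h')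
  exact ⟨g, c, fun x => by rcases hc x with h | h <;> simp [h], hg⟩

/-- A real reflection in the plane of the sites `x` and `y`, acting on both isotropic halves. -/
lemma exists_rotation {x y : Fin N} (hxy : x ≠ y) :
    ∃ g : unitarySymplectic N,
      (∀ z, z ≠ x → z ≠ y → Matrix.toLin' g.1.1 (Pi.single (Sum.inl z) 1) =
        Pi.single (Sum.inl z) 1) ∧
      (∀ z, z ≠ x → z ≠ y → Matrix.toLin' g.1.1 (Pi.single (Sum.inr z) 1) =
        Pi.single (Sum.inr z) 1) ∧
      Matrix.toLin' g.1.1 (Pi.single (Sum.inl x) 1) =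
        (3 / 5 : ℂ) • Pi.single (Sum.inl x) 1 + (4 / 5 : ℂ) • Pi.single (Sum.inl y) 1 ∧
      Matrix.toLin' g.1.1 (Pi.single (Sum.inr x) 1) =
        (3 / 5 : ℂ) • Pi.single (Sum.inr x) 1 + (4 / 5 : ℂ) • Pi.single (Sum.inr y) 1 := by
  -- The squared length is `5`, so the reflection in `v` sends `e_x` to `(3/5) e_x + (4/5) e_y`:
  -- rational entries, none of them zero on this plane.
  let v : Fin N → ℂ := Pi.single x 1 - (2 : ℂ) • Pi.single y 1
  let O : Matrix (Fin N) (Fin N) ℂ := 1 - (2 / 5 : ℂ) • Matrix.vecMulVec v v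
  have hvv : v ⬝ᵥ v = 5 := by
    simp [v, hxy, hxy.symm]
    norm_num
  have hO : O * O = 1 := by
    simp only [O, sub_mul, mul_sub, one_mul, mul_one, smul_mul_smul_comm,
      Matrix.vecMulVec_mul_vecMulVec, hvv, Matrix.vecMulVec_smul]
    module
  have hOt : O.transpose = O := by
    simp [O, Matrix.transpose_sub, Matrix.transpose_smul, Matrix.transpose_vecMulVec]
  have hOc : O.conjTranspose = O := by
    have hv : star v = v := by
      ext i
      by_cases h : i = x <;> by_cases h' : i = y <;> simp [v, h, h', hxy]
    simp [O, Matrix.conjTranspose_sub, Matrix.conjTranspose_smul, Matrix.conjTranspose_vecMulVec,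
      hv]
  obtain ⟨g, hg⟩ := exists_unitarySymplectic (N := N) (U := Matrix.fromBlocks O 0 0 O)
    (by simp [Matrix.fromBlocks_conjTranspose, Matrix.fromBlocks_multiply, hOc, hO])
    (by simp [Matrix.J, Matrix.fromBlocks_transpose, Matrix.fromBlocks_multiply, hOt, hO])
  refine ⟨g, ?_, ?_, ?_, ?_⟩
  · intro z hzx hzy
    ext (i | i)
    · simp [hg, O, v, Matrix.vecMulVec_apply, Pi.single_apply, Matrix.one_apply, hzx, hzy]
    · simp [hg]
  · intro z hzx hzy
    ext (i | i)
    · simp [hg]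
    · simp [hg, O, v, Matrix.vecMulVec_apply, Pi.single_apply, Matrix.one_apply, hzx, hzy]
  · ext (i | i)
    · by_cases h : i = x <;> by_cases h' : i = y <;>
        simp [hg, O, v, Matrix.vecMulVec_apply, hxy, h, h',
          hxy.symm] <;> norm_num
    · simp [hg]
  · ext (i | i)
    · simp [hg]
    · by_cases h : i = x <;> by_cases h' : i = y <;>
        simp [hg, O, v, Matrix.vecMulVec_apply, hxy, h, h',
          hxy.symm] <;> norm_num

end SymplecticElements

/-! ### Permutations matching labellings. -/

section Labels

/-- Two labellings with fibres of equal sizes differ by a permutation. -/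
lemma exists_perm_of_card_fiber {α γ : Type*} [Fintype α] [DecidableEq γ] (f f' : α → γ)
    (h : ∀ c, (Finset.univ.filter fun x => f x = c).card =
      (Finset.univ.filter fun x => f' x = c).card) :
    ∃ σ : Equiv.Perm α, ∀ x, f' (σ x) = f x := by
  refine ⟨Equiv.ofFiberEquiv (f := f) (g := f') fun c => Fintype.equivOfCardEq ?_, fun x =>
    Equiv.ofFiberEquiv_map _ _⟩
  rw [Fintype.card_subtype, Fintype.card_subtype, h]

/-- Membership is added to the label. The fibres outside `K` and `K'` then have equal sizes by
subtraction. -/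
lemma exists_perm_of_card_filter {α γ : Type*} [Fintype α] [DecidableEq γ]
    [DecidableEq α] (g g' : α → γ) (K K' : Finset α)
    (h : ∀ c, (Finset.univ.filter fun x => g x = c).card =
      (Finset.univ.filter fun x => g' x = c).card)
    (hK : ∀ c, (K.filter fun x => g x = c).card = (K'.filter fun x => g' x = c).card) :
    ∃ σ : Equiv.Perm α, ∀ x, g' (σ x) = g x ∧ (σ x ∈ K' ↔ x ∈ K) := by
  obtain ⟨σ, hσ⟩ := exists_perm_of_card_fiber (fun x => (g x, decide (x ∈ K)))
    (fun x => (g' x, decide (x ∈ K'))) (by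
      rintro ⟨c, b⟩
      have h1 : ∀ (g : α → γ) (K : Finset α),
          (Finset.univ.filter fun x => (g x, decide (x ∈ K)) = (c, true)) =
            K.filter fun x => g x = c := fun g K => by
        ext x; simp [and_comm]
      have h2 : ∀ (g : α → γ) (K : Finset α),
          (Finset.univ.filter fun x => (g x, decide (x ∈ K)) = (c, false)) =
            (Finset.univ.filter fun x => g x = c) \ K.filter fun x => g x = c := fun g K => by
        ext x; simp; tauto
      cases b
      · rw [h2, h2, Finset.card_sdiff_of_subset (Finset.filter_subset_filter _ (by simp)),
          Finset.card_sdiff_of_subset (Finset.filter_subset_filter _ (by simp)), h, hK]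
      · rw [h1, h1, hK])
  refine ⟨σ, fun x => ?_⟩
  have := hσ x
  simpa using this

end Labels

/-! ### A maximally paired wedge generates the exterior power. -/

section Cyclic

variable {N n : ℕ}

/-- The sites carrying the first basis vector of their plane. -/
def leftSites (a : Fin n → Fin N ⊕ Fin N) : Finset (Fin N) := (Finset.univ.image a).toLeft

/-- The sites carrying the second basis vector of their plane. -/
def rightSites (a : Fin n → Fin N ⊕ Fin N) : Finset (Fin N) := (Finset.univ.image a).toRight

lemma mem_leftSites {a : Fin n → Fin N ⊕ Fin N} {x : Fin N} :
    x ∈ leftSites a ↔ ∃ i, a i = Sum.inl x := by simp [leftSites]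

lemma mem_rightSites {a : Fin n → Fin N ⊕ Fin N} {x : Fin N} :
    x ∈ rightSites a ↔ ∃ i, a i = Sum.inr x := by simp [rightSites]

lemma card_leftSites_add_card_rightSites {a : Fin n → Fin N ⊕ Fin N}
    (ha : Function.Injective a) : (leftSites a).card + (rightSites a).card = n := by
  rw [leftSites, rightSites, Finset.card_toLeft_add_card_toRight,
    Finset.card_image_of_injective _ ha, Finset.card_univ, Fintype.card_fin]

lemma exists_perm_of_sites_eq {a a' : Fin n → Fin N ⊕ Fin N} (ha : Function.Injective a)
    (ha' : Function.Injective a') (hl : leftSites a = leftSites a')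
    (hr : rightSites a = rightSites a') : ∃ π : Equiv.Perm (Fin n), a' = a ∘ π := by
  refine exists_perm_of_image_eq ha ha' ?_
  rw [← Finset.toLeft_disjSum_toRight (u := Finset.univ.image a),
    ← Finset.toLeft_disjSum_toRight (u := Finset.univ.image a')]
  exact congrArg₂ _ hl hr

lemma mem_leftSites_sumCongr {a : Fin n → Fin N ⊕ Fin N} (σ : Equiv.Perm (Fin N)) {x : Fin N} :
    σ x ∈ leftSites (Equiv.sumCongr σ σ ∘ a) ↔ x ∈ leftSites a := by
  simp only [mem_leftSites, Function.comp_apply]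
  refine exists_congr fun i => ?_
  rcases a i with z | z <;> simp

lemma mem_rightSites_sumCongr {a : Fin n → Fin N ⊕ Fin N} (σ : Equiv.Perm (Fin N)) {x : Fin N} :
    σ x ∈ rightSites (Equiv.sumCongr σ σ ∘ a) ↔ x ∈ rightSites a := by
  simp only [mem_rightSites, Function.comp_apply]
  refine exists_congr fun i => ?_
  rcases a i with z | z <;> simp

lemma siteFlip_siteFlip (s : Fin N) (z : Fin N ⊕ Fin N) : siteFlip s (siteFlip s z) = z :=
  Equiv.swap_apply_self _ _ _

lemma mem_leftSites_siteFlip {a : Fin n → Fin N ⊕ Fin N} (s : Fin N) {x : Fin N} :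
    x ∈ leftSites (siteFlip s ∘ a) ↔ if x = s then x ∈ rightSites a else x ∈ leftSites a := by
  have h : ∀ i, siteFlip s (a i) = Sum.inl x ↔ a i = siteFlip s (Sum.inl x) := fun i => by
    rw [← (siteFlip s).injective.eq_iff, siteFlip_siteFlip]
  simp only [mem_leftSites, mem_rightSites, Function.comp_apply, h, siteFlip_inl]
  split_ifs <;> rfl

lemma mem_rightSites_siteFlip {a : Fin n → Fin N ⊕ Fin N} (s : Fin N) {x : Fin N} :
    x ∈ rightSites (siteFlip s ∘ a) ↔ if x = s then x ∈ leftSites a else x ∈ rightSites a := by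
  have h : ∀ i, siteFlip s (a i) = Sum.inr x ↔ a i = siteFlip s (Sum.inr x) := fun i => by
    rw [← (siteFlip s).injective.eq_iff, siteFlip_siteFlip]
  simp only [mem_leftSites, mem_rightSites, Function.comp_apply, h, siteFlip_inr]
  split_ifs <;> rfl

/-- A subspace of the exterior power stable under `Sp(2N)`. -/
def IsSpStable (W : Submodule ℂ (⋀[ℂ]^n (Fin N ⊕ Fin N → ℂ))) : Prop :=
  ∀ g : unitarySymplectic N, ∀ w ∈ W, exteriorPower.map n (Matrix.toLin' g.1.1) w ∈ W

variable {W : Submodule ℂ (⋀[ℂ]^n (Fin N ⊕ Fin N → ℂ))}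

lemma IsSpStable.wedge_monomial (hW : IsSpStable W) {τ : Equiv.Perm (Fin N ⊕ Fin N)}
    {c : Fin N ⊕ Fin N → ℂ} (hc : ∀ x, c x ≠ 0)
    (hg : ∃ g : unitarySymplectic N, g.1.1 = monomialMatrix τ c)
    {a : Fin n → Fin N ⊕ Fin N} (ha : wedge a ∈ W) : wedge (τ ∘ a) ∈ W := by
  obtain ⟨g, hg⟩ := hg
  have := hW g _ ha
  rw [hg, map_monomialMatrix_wedge] at this
  exact (Submodule.smul_mem_iff _ (Finset.prod_ne_zero_iff.2 fun i _ => hc _)).1 this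

lemma IsSpStable.wedge_sumCongr (hW : IsSpStable W) (σ : Equiv.Perm (Fin N))
    {a : Fin n → Fin N ⊕ Fin N} (ha : wedge a ∈ W) : wedge (Equiv.sumCongr σ σ ∘ a) ∈ W :=
  hW.wedge_monomial (by simp) (exists_permutation σ) ha

lemma IsSpStable.wedge_siteFlip (hW : IsSpStable W) (s : Fin N)
    {a : Fin n → Fin N ⊕ Fin N} (ha : wedge (siteFlip s ∘ a) ∈ W) : wedge a ∈ W := by
  obtain ⟨g, c, hc, hg⟩ := exists_siteFlip s
  have := hW.wedge_monomial hc ⟨g, hg⟩ ha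
  rwa [← Function.comp_assoc, show ⇑(siteFlip s) ∘ ⇑(siteFlip s) = id from
    funext (siteFlip_siteFlip s), Function.id_comp] at this

lemma wedge_comp_perm_mem {a : Fin n → Fin N ⊕ Fin N} (π : Equiv.Perm (Fin n))
    (ha : wedge a ∈ W) : wedge (a ∘ π) ∈ W := by
  rw [wedge_comp_perm]
  rcases Int.units_eq_one_or (Equiv.Perm.sign π) with h | h <;> simp [h, ha]

lemma update_comp_single {κ : Type*} [DecidableEq κ] (a : Fin n → κ) (i j : Fin n) (p q : κ) :
    (fun k => (Pi.single (Function.update (Function.update a i p) j q k) 1 : κ → ℂ)) =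
      Function.update (Function.update (fun k => Pi.single (a k) 1) i (Pi.single p 1)) j
        (Pi.single q 1) := by
  ext1 k
  simp only [Function.update_apply]
  split_ifs <;> rfl

/-- Two unpaired basis vectors are obtained by rotating a pair. -/
lemma IsSpStable.wedge_of_pairs (hW : IsSpStable W) {a : Fin n → Fin N ⊕ Fin N} {i j : Fin n}
    {x y : Fin N} (hxy : x ≠ y) (hi : a i = Sum.inl x) (hj : a j = Sum.inr y)
    (hl : ∀ k, k ≠ i → a k ≠ Sum.inl x ∧ a k ≠ Sum.inl y)
    (hr : ∀ k, k ≠ j → a k ≠ Sum.inr x ∧ a k ≠ Sum.inr y)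
    (hxx : wedge (Function.update (Function.update a i (Sum.inl x)) j (Sum.inr x)) ∈ W)
    (hyy : wedge (Function.update (Function.update a i (Sum.inl y)) j (Sum.inr y)) ∈ W) :
    wedge a ∈ W := by
  have hij : i ≠ j := by rintro rfl; simp [hi] at hj
  let F : Fin N ⊕ Fin N → Fin N ⊕ Fin N → ⋀[ℂ]^n (Fin N ⊕ Fin N → ℂ) := fun p q =>
    wedge (Function.update (Function.update a i p) j q)
  have hF : wedge a = F (Sum.inl x) (Sum.inr y) := by
    simp only [F, ← hi, ← hj]
    rw [Function.update_eq_self, Function.update_eq_self]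
  obtain ⟨g, hgl, hgr, hgx, hgx'⟩ := exists_rotation hxy
  have h1 : exteriorPower.map n (Matrix.toLin' g.1.1) (F (Sum.inl x) (Sum.inr x)) =
      (9 / 25 : ℂ) • F (Sum.inl x) (Sum.inr x) + (16 / 25 : ℂ) • F (Sum.inl y) (Sum.inr y) +
      (12 / 25 : ℂ) • (F (Sum.inl x) (Sum.inr y) + F (Sum.inl y) (Sum.inr x)) := by
    have h2 : (Matrix.toLin' g.1.1 : (Fin N ⊕ Fin N → ℂ) → _) ∘
        Function.update (Function.update (fun k => Pi.single (a k) 1) i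
          (Pi.single (Sum.inl x) 1)) j (Pi.single (Sum.inr x) 1) =
        Function.update (Function.update (fun k => Pi.single (a k) 1) i
          ((3 / 5 : ℂ) • Pi.single (Sum.inl x) 1 + (4 / 5 : ℂ) • Pi.single (Sum.inl y) 1)) j
          ((3 / 5 : ℂ) • Pi.single (Sum.inr x) 1 + (4 / 5 : ℂ) • Pi.single (Sum.inr y) 1) := by
      ext1 k
      rw [Function.comp_apply]
      by_cases hkj : k = j
      · subst hkj; rw [Function.update_self, Function.update_self, hgx']
      rw [Function.update_of_ne hkj, Function.update_of_ne hkj]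
      by_cases hki : k = i
      · subst hki; rw [Function.update_self, Function.update_self, hgx]
      rw [Function.update_of_ne hki, Function.update_of_ne hki]
      have hl' := hl k hki
      have hr' := hr k hkj
      rcases h : a k with z | z
      · rw [h] at hl'
        exact hgl z (by simpa using hl'.1) (by simpa using hl'.2)
      · rw [h] at hr'
        exact hgr z (by simpa using hr'.1) (by simpa using hr'.2)
    simp only [F, wedge, update_comp_single]
    rw [exteriorPower.map_apply_ιMulti, h2]
    have hleft : ∀ (A : Fin n → Fin N ⊕ Fin N → ℂ) (u u' v : Fin N ⊕ Fin N → ℂ) (s t : ℂ),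
        exteriorPower.ιMulti ℂ n
          (Function.update (Function.update A i (s • u + t • u')) j v) =
        s • exteriorPower.ιMulti ℂ n (Function.update (Function.update A i u) j v) +
        t • exteriorPower.ιMulti ℂ n (Function.update (Function.update A i u') j v) := by
      intro A u u' v s t
      rw [Function.update_comm hij, AlternatingMap.map_update_add, AlternatingMap.map_update_smul,
        AlternatingMap.map_update_smul, Function.update_comm hij, Function.update_comm hij]
    rw [AlternatingMap.map_update_add, AlternatingMap.map_update_smul,
      AlternatingMap.map_update_smul, hleft, hleft]
    module
  -- The rotated pair and both pure pairs lie in `W`, which isolates the mixed part.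
  have h3 : F (Sum.inl x) (Sum.inr y) + F (Sum.inl y) (Sum.inr x) ∈ W := by
    have := hW g _ hxx
    change exteriorPower.map n (Matrix.toLin' g.1.1) (F (Sum.inl x) (Sum.inr x)) ∈ W at this
    rw [h1, Submodule.add_mem_iff_right _ (W.add_mem (W.smul_mem _ hxx) (W.smul_mem _ hyy)),
      Submodule.smul_mem_iff _ (by norm_num)] at this
    exact this
  obtain ⟨t, ht⟩ := exists_torus x
  have h4 : ∀ p q, (∏ k, torusWeight x (Function.update (Function.update a i p) j q k)) =
      torusWeight x p * torusWeight x q := by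
    intro p q
    rw [← Finset.mul_prod_erase _ _ (Finset.mem_univ j), Function.update_self,
      ← Finset.mul_prod_erase (Finset.univ.erase j) _ (Finset.mem_erase.2 ⟨hij, Finset.mem_univ i⟩),
      Function.update_of_ne hij, Function.update_self, Finset.prod_eq_one, mul_one, mul_comm]
    intro k hk
    rw [Finset.mem_erase, Finset.mem_erase] at hk
    rw [Function.update_of_ne hk.2.1, Function.update_of_ne hk.1]
    have hl' := (hl k hk.1).1
    have hr' := (hr k hk.2.1).1
    rcases h : a k with z | z
    · rw [h] at hl'
      simp [torusWeight, show z ≠ x by simpa using hl']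
    · rw [h] at hr'
      simp [torusWeight, show z ≠ x by simpa using hr']
  have h5 := hW t _ h3
  rw [ht, map_add, map_monomialMatrix_wedge, map_monomialMatrix_wedge, h4, h4] at h5
  -- The torus element at `x` multiplies the two mixed terms by `i` and `-i`; adding `i` times their
  -- sum cancels the second.
  have h6 : (2 * Complex.I) • F (Sum.inl x) (Sum.inr y) ∈ W := by
    convert W.add_mem h5 (W.smul_mem Complex.I h3) using 1
    simp only [torusWeight, Sum.elim_inl, Sum.elim_inr, if_true, hxy.symm, if_false,
      Equiv.coe_refl, Function.id_comp]
    simp only [F]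
    module
  rw [hF]
  exact (Submodule.smul_mem_iff _ (by simp)).1 h6

/-- With at most one unpaired site, `n` fixes the numbers of left and right sites, so a site
permutation carries one tuple to the other up to reordering. -/
lemma IsSpStable.wedge_of_card_le_one (hW : IsSpStable W) {a₀ a : Fin n → Fin N ⊕ Fin N}
    (h₀ : Function.Injective a₀) (hsub₀ : rightSites a₀ ⊆ leftSites a₀)
    (hcard₀ : (leftSites a₀).card ≤ (rightSites a₀).card + 1)
    (ha : Function.Injective a) (hsub : rightSites a ⊆ leftSites a)
    (hcard : (leftSites a).card ≤ (rightSites a).card + 1)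
    (hmem : wedge a₀ ∈ W) : wedge a ∈ W := by
  have e₀ := card_leftSites_add_card_rightSites h₀
  have e := card_leftSites_add_card_rightSites ha
  have c₀ := Finset.card_le_card hsub₀
  have c := Finset.card_le_card hsub
  have hL : (leftSites a₀).card = (leftSites a).card := by omega
  have hR : (rightSites a₀).card = (rightSites a).card := by omega
  obtain ⟨σ, hσ⟩ := exists_perm_of_card_filter (fun x => decide (x ∈ leftSites a₀))
    (fun x => decide (x ∈ leftSites a)) (rightSites a₀) (rightSites a) (by
      have h1 : ∀ S : Finset (Fin N), (Finset.univ.filter fun x => decide (x ∈ S) = true) = S :=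
        fun S => by ext; simp
      have h2 : ∀ S : Finset (Fin N), (Finset.univ.filter fun x => decide (x ∈ S) = false) = Sᶜ :=
        fun S => by ext; simp
      rintro (c | c)
      · rw [h2, h2, Finset.card_compl, Finset.card_compl, hL]
      · rw [h1, h1, hL]) (by
      rintro (c | c)
      · rw [Finset.filter_false_of_mem, Finset.filter_false_of_mem]
        · intro x hx
          simpa using hsub hx
        · intro x hx
          simpa using hsub₀ hx
      · rw [Finset.filter_true_of_mem, Finset.filter_true_of_mem, hR]
        · intro x hx
          simpa using hsub hx
        · intro x hx
          simpa using hsub₀ hx)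
  obtain ⟨π, hπ⟩ := exists_perm_of_sites_eq (a := Equiv.sumCongr σ σ ∘ a₀) (a' := a)
    ((Equiv.injective _).comp h₀) ha
    (by
      ext x
      obtain ⟨x, rfl⟩ := σ.surjective x
      rw [mem_leftSites_sumCongr]
      simpa using (hσ x).1.symm)
    (by
      ext x
      obtain ⟨x, rfl⟩ := σ.surjective x
      rw [mem_rightSites_sumCongr]
      exact (hσ x).2.symm)
  rw [hπ]
  exact wedge_comp_perm_mem π (hW.wedge_sumCongr σ hmem)

/-- A stable subspace containing a maximally paired wedge contains every wedge. -/
lemma IsSpStable.wedge_mem (hW : IsSpStable W) {a₀ : Fin n → Fin N ⊕ Fin N}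
    (h₀ : Function.Injective a₀) (hsub₀ : rightSites a₀ ⊆ leftSites a₀)
    (hcard₀ : (leftSites a₀).card ≤ (rightSites a₀).card + 1) (hmem : wedge a₀ ∈ W)
    (m : ℕ) (a : Fin n → Fin N ⊕ Fin N)
    (hm : (symmDiff (leftSites a) (rightSites a)).card = m) : wedge a ∈ W := by
  -- Induction on the number `m` of unpaired sites, which flips leave unchanged.
  induction m using Nat.strong_induction_on generalizing a with
  | _ m ih =>
    by_cases ha : Function.Injective a
    swap
    · rw [wedge_eq_zero ha]; exact W.zero_mem
    have hflip : ∀ (s : Fin N) (b : Fin n → Fin N ⊕ Fin N),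
        symmDiff (leftSites (siteFlip s ∘ b)) (rightSites (siteFlip s ∘ b)) =
          symmDiff (leftSites b) (rightSites b) := by
      intro s b
      ext x
      rw [Finset.mem_symmDiff, Finset.mem_symmDiff, mem_leftSites_siteFlip, mem_rightSites_siteFlip]
      split_ifs <;> tauto
    rcases le_or_gt m 1 with h1 | h1
    · have base : ∀ b : Fin n → Fin N ⊕ Fin N, Function.Injective b →
          (symmDiff (leftSites b) (rightSites b)).card ≤ 1 → rightSites b ⊆ leftSites b →
          wedge b ∈ W := by
        intro b hb hc hsub
        refine hW.wedge_of_card_le_one h₀ hsub₀ hcard₀ hb hsub ?_ hmem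
        rw [symmDiff_of_ge hsub, Finset.card_sdiff_of_subset hsub] at hc
        omega
      by_cases hsub : rightSites a ⊆ leftSites a
      · exact base a ha (hm.trans_le h1) hsub
      -- The only unpaired site is occupied on the right; flipping it gives the case already
      -- treated.
      · obtain ⟨s, hs, hs'⟩ := Finset.not_subset.1 hsub
        refine hW.wedge_siteFlip s (base _ ((siteFlip s).injective.comp ha)
          (by rw [hflip]; omega) fun x hx => ?_)
        rw [mem_rightSites_siteFlip] at hx
        rw [mem_leftSites_siteFlip]
        split_ifs at hx ⊢ with hxs
        · rw [hxs]; exact hs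
        · by_contra hx'
          have hone := Finset.card_le_one.1 (hm.trans_le h1)
          exact hxs (hone x (Finset.mem_symmDiff.2 (Or.inr ⟨hx, hx'⟩)) s
            (Finset.mem_symmDiff.2 (Or.inr ⟨hs, hs'⟩)))
    · have step : ∀ (b : Fin n → Fin N ⊕ Fin N), Function.Injective b →
          (symmDiff (leftSites b) (rightSites b)).card = m → ∀ x y, x ≠ y →
          x ∈ leftSites b → x ∉ rightSites b → y ∈ rightSites b → y ∉ leftSites b →
          wedge b ∈ W := by
        intro b hb hbm x y hxy hxl hxr hyr hyl
        obtain ⟨i, hi⟩ := mem_leftSites.1 hxl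
        obtain ⟨j, hj⟩ := mem_rightSites.1 hyr
        have hij : i ≠ j := by rintro rfl; simp [hi] at hj
        have hxr' : ∀ k, b k ≠ Sum.inr x := fun k hk => hxr (mem_rightSites.2 ⟨k, hk⟩)
        have hyl' : ∀ k, b k ≠ Sum.inl y := fun k hk => hyl (mem_leftSites.2 ⟨k, hk⟩)
        have hpair : ∀ z, (z = x ∨ z = y) →
            wedge (Function.update (Function.update b i (Sum.inl z)) j (Sum.inr z)) ∈ W := by
          intro z hz
          have hL : ∀ s, s ∈ leftSites (Function.update (Function.update b i (Sum.inl z)) j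
              (Sum.inr z)) ↔ s = z ∨ (s ≠ x ∧ s ∈ leftSites b) := by
            intro s
            simp only [mem_leftSites]
            constructor
            · rintro ⟨k, hk⟩
              by_cases hkj : k = j
              · subst hkj; simp at hk
              rw [Function.update_of_ne hkj] at hk
              by_cases hki : k = i
              · subst hki
                rw [Function.update_self] at hk
                exact Or.inl (Sum.inl_injective hk).symm
              rw [Function.update_of_ne hki] at hk
              refine Or.inr ⟨?_, k, hk⟩
              rintro rfl
              exact hki (hb (hk.trans hi.symm))
            · rintro (rfl | ⟨hsx, k, hk⟩)
              · exact ⟨i, by rw [Function.update_of_ne hij, Function.update_self]⟩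
              · refine ⟨k, ?_⟩
                rw [Function.update_of_ne, Function.update_of_ne, hk]
                · rintro rfl
                  exact hsx (Sum.inl_injective (hk.symm.trans hi))
                · rintro rfl
                  simp [hj] at hk
          have hR : ∀ s, s ∈ rightSites (Function.update (Function.update b i (Sum.inl z)) j
              (Sum.inr z)) ↔ s = z ∨ (s ≠ y ∧ s ∈ rightSites b) := by
            intro s
            simp only [mem_rightSites]
            constructor
            · rintro ⟨k, hk⟩
              by_cases hkj : k = j
              · subst hkj
                rw [Function.update_self] at hk
                exact Or.inl (Sum.inr_injective hk).symm
              rw [Function.update_of_ne hkj] at hk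
              by_cases hki : k = i
              · subst hki; simp at hk
              rw [Function.update_of_ne hki] at hk
              refine Or.inr ⟨?_, k, hk⟩
              rintro rfl
              exact hkj (hb (hk.trans hj.symm))
            · rintro (rfl | ⟨hsy, k, hk⟩)
              · exact ⟨j, by rw [Function.update_self]⟩
              · refine ⟨k, ?_⟩
                rw [Function.update_of_ne, Function.update_of_ne, hk]
                · rintro rfl
                  simp [hi] at hk
                · rintro rfl
                  exact hsy (Sum.inr_injective (hk.symm.trans hj))
          refine ih _ ?_ _ rfl
          rw [← hbm]
          -- Placing both vectors at `z` leaves `x` and `y` each either paired or empty, so both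
          -- drop out of the symmetric difference.
          refine Finset.card_lt_card (Finset.ssubset_iff_subset_ne.2 ⟨fun s hs => ?_, fun h => ?_⟩)
          · rw [Finset.mem_symmDiff, hL, hR] at hs
            rw [Finset.mem_symmDiff]
            by_cases hsx : s = x
            · subst hsx; exact Or.inl ⟨hxl, hxr⟩
            by_cases hsy : s = y
            · subst hsy; exact Or.inr ⟨hyr, hyl⟩
            have hsz : s ≠ z := by rcases hz with rfl | rfl <;> assumption
            tauto
          · have hx := Finset.ext_iff.1 h x
            rw [Finset.mem_symmDiff, Finset.mem_symmDiff, hL, hR] at hx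
            tauto
        refine hW.wedge_of_pairs hxy hi hj (fun k hk => ⟨fun h => hk (hb (h.trans hi.symm)),
          hyl' k⟩) (fun k hk => ⟨hxr' k, fun h => hk (hb (h.trans hj.symm))⟩)
          (hpair x (Or.inl rfl)) (hpair y (Or.inr rfl))
      -- Flips at two unpaired sites arrange `x` on the left and `y` on the right, as `step`
      -- requires.
      obtain ⟨x, hx, y, hy, hxy⟩ := Finset.one_lt_card.1 (hm ▸ h1)
      have step' : ∀ (b : Fin n → Fin N ⊕ Fin N), Function.Injective b →
          (symmDiff (leftSites b) (rightSites b)).card = m →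
          x ∈ leftSites b → x ∉ rightSites b → y ∈ symmDiff (leftSites b) (rightSites b) →
          wedge b ∈ W := by
        intro b hb hbm hxl hxr hy
        rcases Finset.mem_symmDiff.1 hy with ⟨hyl, hyr⟩ | ⟨hyr, hyl⟩
        · refine hW.wedge_siteFlip y (step _ ((siteFlip y).injective.comp hb)
            (by rw [hflip]; exact hbm) x y hxy ?_ ?_ ?_ ?_) <;>
          simp only [mem_leftSites_siteFlip, mem_rightSites_siteFlip, if_true, if_neg hxy] <;>
          assumption
        · exact step b hb hbm x y hxy hxl hxr hyr hyl
      rcases Finset.mem_symmDiff.1 hx with ⟨hxl, hxr⟩ | ⟨hxr, hxl⟩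
      · exact step' a ha hm hxl hxr hy
      · refine hW.wedge_siteFlip x (step' _ ((siteFlip x).injective.comp ha)
          (by rw [hflip]; exact hm) ?_ ?_ (by rw [hflip]; exact hy)) <;>
        simp only [mem_leftSites_siteFlip, mem_rightSites_siteFlip, if_true] <;>
        assumption

lemma IsSpStable.eq_top (hW : IsSpStable W) {a₀ : Fin n → Fin N ⊕ Fin N}
    (h₀ : Function.Injective a₀) (hsub₀ : rightSites a₀ ⊆ leftSites a₀)
    (hcard₀ : (leftSites a₀).card ≤ (rightSites a₀).card + 1) (hmem : wedge a₀ ∈ W) : W = ⊤ := by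
  rw [eq_top_iff, ← span_range_wedge, Submodule.span_le]
  rintro _ ⟨a, rfl⟩
  exact hW.wedge_mem h₀ hsub₀ hcard₀ hmem _ a rfl

end Cyclic

/-! ### The upper bound for the commutant. -/

section UpperBound

variable {N n : ℕ}

lemma exists_paired_tuple (hn : n ≤ 2 * N) : ∃ a : Fin n → Fin N ⊕ Fin N,
    Function.Injective a ∧ rightSites a ⊆ leftSites a ∧
      (leftSites a).card ≤ (rightSites a).card + 1 := by
  let a : Fin n → Fin N ⊕ Fin N := fun i =>
    if i.1 % 2 = 0 then Sum.inl ⟨i.1 / 2, by omega⟩ else Sum.inr ⟨i.1 / 2, by omega⟩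
  have hL : ∀ x : Fin N, x ∈ leftSites a ↔ 2 * x.1 < n := by
    intro x
    rw [mem_leftSites]
    constructor
    · rintro ⟨i, hi⟩
      by_cases h : i.1 % 2 = 0 <;> simp [a, h, Fin.ext_iff] at hi
      omega
    · exact fun h => ⟨⟨2 * x.1, h⟩, by simp [a]⟩
  have hR : ∀ x : Fin N, x ∈ rightSites a ↔ 2 * x.1 + 1 < n := by
    intro x
    rw [mem_rightSites]
    constructor
    · rintro ⟨i, hi⟩
      by_cases h : i.1 % 2 = 0 <;> simp [a, h, Fin.ext_iff] at hi
      omega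
    · refine fun h => ⟨⟨2 * x.1 + 1, h⟩, ?_⟩
      have h1 : (2 * x.1 + 1) % 2 ≠ 0 := by omega
      have h2 : (2 * x.1 + 1) / 2 = x.1 := by omega
      simp [a, h2]
  have hsub : rightSites a ⊆ leftSites a := fun x hx => by rw [hL]; rw [hR] at hx; omega
  refine ⟨a, fun i j hij => ?_, hsub, ?_⟩
  · by_cases h : i.1 % 2 = 0 <;> by_cases h' : j.1 % 2 = 0 <;> simp [a, h, h'] at hij <;>
      ext <;> omega
  · have h1 : (leftSites a \ rightSites a).card ≤ 1 := by
      refine Finset.card_le_one.2 fun x hx y hy => ?_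
      rw [Finset.mem_sdiff, hL, hR] at hx hy
      ext
      omega
    have h2 := Finset.card_sdiff_add_card_eq_card hsub
    omega

lemma prod_torusWeight {a : Fin n → Fin N ⊕ Fin N} (ha : Function.Injective a) (s : Fin N) :
    ∏ i, torusWeight s (a i) =
      (if s ∈ leftSites a then Complex.I else 1) * (if s ∈ rightSites a then -Complex.I else 1) := by
  rw [← Finset.prod_image (s := Finset.univ) (g := a) (f := torusWeight s) fun i _ j _ h => ha h,
    ← Finset.toLeft_disjSum_toRight (u := Finset.univ.image a), Finset.prod_disjSum]
  simp only [torusWeight, Sum.elim_inl, Sum.elim_inr, Finset.prod_ite_eq']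
  rfl

/-- Two tuples occupy singly the same lines, hence have the same weight. -/
def SameWeight (a b : Fin n → Fin N ⊕ Fin N) : Prop :=
  ∀ s, (s ∈ leftSites a ∧ s ∉ rightSites a ↔ s ∈ leftSites b ∧ s ∉ rightSites b) ∧
    (s ∉ leftSites a ∧ s ∈ rightSites a ↔ s ∉ leftSites b ∧ s ∈ rightSites b)

/-- At each site the torus eigenvalue is `i` for left only, `-i` for right only, and `1` for empty
or paired; imaginary parts separate these cases. -/
lemma sameWeight_of_prod_eq {a b : Fin n → Fin N ⊕ Fin N} (ha : Function.Injective a)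
    (hb : Function.Injective b)
    (h : ∀ s, ∏ i, torusWeight s (a i) = ∏ i, torusWeight s (b i)) : SameWeight a b := by
  intro s
  have hs := h s
  rw [prod_torusWeight ha, prod_torusWeight hb] at hs
  have him := congrArg Complex.im hs
  by_cases p : s ∈ leftSites a <;> by_cases q : s ∈ rightSites a <;>
    by_cases r : s ∈ leftSites b <;> by_cases t : s ∈ rightSites b <;>
    simp [p, q, r, t] at him ⊢ <;> norm_num at him

variable {a₀ : Fin n → Fin N ⊕ Fin N}

lemma card_rightSites_eq {a : Fin n → Fin N ⊕ Fin N} (h₀ : Function.Injective a₀)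
    (ha : Function.Injective a) (hw : SameWeight a a₀) :
    (rightSites a).card = (rightSites a₀).card := by
  have e₀ := card_leftSites_add_card_rightSites h₀
  have e := card_leftSites_add_card_rightSites ha
  have h1 : leftSites a \ rightSites a = leftSites a₀ \ rightSites a₀ := by
    ext s; simpa using (hw s).1
  have h2 : rightSites a \ leftSites a = rightSites a₀ \ leftSites a₀ := by
    ext s; simpa [and_comm] using (hw s).2
  have c1 := Finset.card_sdiff_add_card_inter (leftSites a) (rightSites a)
  have c2 := Finset.card_sdiff_add_card_inter (rightSites a) (leftSites a)
  have c3 := Finset.card_sdiff_add_card_inter (leftSites a₀) (rightSites a₀)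
  have c4 := Finset.card_sdiff_add_card_inter (rightSites a₀) (leftSites a₀)
  rw [Finset.inter_comm] at c2 c4
  rw [h1] at c1
  rw [h2] at c2
  omega

/-- Equal weight keeps right sites away from the unpaired left sites of `a₀`. What remains is the
overlap with the pairs of `a₀`, equal by hypothesis, and the empty sites of `a₀`, which account for
the rest of an equal total. -/
lemma card_filter_rightSites_eq {a a' : Fin n → Fin N ⊕ Fin N} (h₀ : Function.Injective a₀)
    (hsub₀ : rightSites a₀ ⊆ leftSites a₀)
    (ha : Function.Injective a) (ha' : Function.Injective a') (hw : SameWeight a a₀)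
    (hw' : SameWeight a' a₀)
    (hcard : (rightSites a₀ ∩ rightSites a).card = (rightSites a₀ ∩ rightSites a').card)
    (c : Bool × Bool) :
    ((rightSites a).filter fun x =>
      (decide (x ∈ leftSites a₀), decide (x ∈ rightSites a₀)) = c).card =
    ((rightSites a').filter fun x =>
      (decide (x ∈ leftSites a₀), decide (x ∈ rightSites a₀)) = c).card := by
  have hR := card_rightSites_eq h₀ ha hw
  have hR' := card_rightSites_eq h₀ ha' hw'
  have hmem : ∀ {b : Fin n → Fin N ⊕ Fin N}, SameWeight b a₀ → ∀ x ∈ rightSites b,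
      x ∈ leftSites a₀ → x ∈ rightSites a₀ := fun hb x hx hl => by
    by_contra hr
    exact ((hb x).1.2 ⟨hl, hr⟩).2 hx
  have htt : ∀ b : Fin n → Fin N ⊕ Fin N, ((rightSites b).filter fun x =>
      (decide (x ∈ leftSites a₀), decide (x ∈ rightSites a₀)) = (true, true)) =
      rightSites a₀ ∩ rightSites b := fun b => by
    ext x
    simp only [Finset.mem_filter, Prod.mk.injEq, decide_eq_true_eq, Finset.mem_inter]
    exact ⟨fun h => ⟨h.2.2, h.1⟩, fun h => ⟨h.2, hsub₀ h.1, h.1⟩⟩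
  have hff : ∀ b : Fin n → Fin N ⊕ Fin N, SameWeight b a₀ → ((rightSites b).filter fun x =>
      (decide (x ∈ leftSites a₀), decide (x ∈ rightSites a₀)) = (false, false)) =
      rightSites b \ rightSites a₀ := fun b hb => by
    ext x
    simp only [Finset.mem_filter, Prod.mk.injEq, decide_eq_false_iff_not, Finset.mem_sdiff]
    exact ⟨fun h => ⟨h.1, h.2.2⟩, fun h => ⟨h.1, fun hl => h.2 (hmem hb x h.1 hl), h.2⟩⟩
  have htf : ∀ b : Fin n → Fin N ⊕ Fin N, SameWeight b a₀ → ((rightSites b).filter fun x =>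
      (decide (x ∈ leftSites a₀), decide (x ∈ rightSites a₀)) = (true, false)) = ∅ :=
    fun b hb => by
    refine Finset.filter_false_of_mem fun x hx h => ?_
    simp only [Prod.mk.injEq, decide_eq_true_eq, decide_eq_false_iff_not] at h
    exact h.2 (hmem hb x hx h.1)
  have hft : ∀ b : Fin n → Fin N ⊕ Fin N, ((rightSites b).filter fun x =>
      (decide (x ∈ leftSites a₀), decide (x ∈ rightSites a₀)) = (false, true)) = ∅ :=
    fun b => by
    refine Finset.filter_false_of_mem fun x hx h => ?_
    simp only [Prod.mk.injEq, decide_eq_true_eq, decide_eq_false_iff_not] at h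
    exact h.1 (hsub₀ h.2)
  rcases c with ⟨_ | _, _ | _⟩
  · rw [hff a hw, hff a' hw']
    have c1 := Finset.card_sdiff_add_card_inter (rightSites a) (rightSites a₀)
    have c2 := Finset.card_sdiff_add_card_inter (rightSites a') (rightSites a₀)
    rw [Finset.inter_comm] at c1 c2
    omega
  · rw [hft, hft]
  · rw [htf a hw, htf a' hw']
  · rw [htt, htt, hcard]

/-- Tuples of the weight of `a₀` with the same overlap with `a₀` are conjugate under the
stabilizer of `a₀`. -/
lemma exists_perm_of_card_inter {a a' : Fin n → Fin N ⊕ Fin N} (h₀ : Function.Injective a₀)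
    (hsub₀ : rightSites a₀ ⊆ leftSites a₀)
    (ha : Function.Injective a) (ha' : Function.Injective a') (hw : SameWeight a a₀)
    (hw' : SameWeight a' a₀)
    (hcard : (rightSites a₀ ∩ rightSites a).card = (rightSites a₀ ∩ rightSites a').card) :
    ∃ σ : Equiv.Perm (Fin N), ∃ π π₀ : Equiv.Perm (Fin n),
      a' = (Equiv.sumCongr σ σ ∘ a) ∘ π ∧ a₀ = (Equiv.sumCongr σ σ ∘ a₀) ∘ π₀ := by
  -- `σ` preserves the left and right sites of `a₀` and carries the right sites of `a` to those of
  -- `a'`. The left sites then follow from the common weight.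
  obtain ⟨σ, hσ⟩ := exists_perm_of_card_filter
    (fun x => (decide (x ∈ leftSites a₀), decide (x ∈ rightSites a₀)))
    (fun x => (decide (x ∈ leftSites a₀), decide (x ∈ rightSites a₀))) (rightSites a)
    (rightSites a') (fun _ => rfl)
    (card_filter_rightSites_eq h₀ hsub₀ ha ha' hw hw' hcard)
  have hL₀ : ∀ x, σ x ∈ leftSites a₀ ↔ x ∈ leftSites a₀ := fun x => by
    simpa using congrArg Prod.fst (hσ x).1
  have hR₀ : ∀ x, σ x ∈ rightSites a₀ ↔ x ∈ rightSites a₀ := fun x => by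
    simpa using congrArg Prod.snd (hσ x).1
  have hinj : Function.Injective (Equiv.sumCongr σ σ) := Equiv.injective _
  obtain ⟨π, hπ⟩ := exists_perm_of_sites_eq (hinj.comp ha) ha'
    (by
      ext x
      obtain ⟨x, rfl⟩ := σ.surjective x
      rw [mem_leftSites_sumCongr]
      have h1 := hw x
      have h2 := hw' (σ x)
      have h3 := (hσ x).2
      rw [hL₀, hR₀, h3] at h2
      by_cases hx : x ∈ rightSites a
      · simp only [hx, and_true] at h1 h2
        exact (not_iff_not.1 (h1.2.trans h2.2.symm))
      · simp only [hx, not_false_eq_true, and_true] at h1 h2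
        exact h1.1.trans h2.1.symm)
    (by
      ext x
      obtain ⟨x, rfl⟩ := σ.surjective x
      rw [mem_rightSites_sumCongr]
      exact (hσ x).2.symm)
  obtain ⟨π₀, hπ₀⟩ := exists_perm_of_sites_eq (hinj.comp h₀) h₀
    (by
      ext x
      obtain ⟨x, rfl⟩ := σ.surjective x
      rw [mem_leftSites_sumCongr, hL₀])
    (by
      ext x
      obtain ⟨x, rfl⟩ := σ.surjective x
      rw [mem_rightSites_sumCongr, hR₀])
  exact ⟨σ, π, π₀, hπ, hπ₀⟩

variable {T : ⋀[ℂ]^n (Fin N ⊕ Fin N → ℂ) →ₗ[ℂ] ⋀[ℂ]^n (Fin N ⊕ Fin N → ℂ)}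

/-- The vector `T (wedge a₀)` has no coordinates outside the weight of `a₀`. -/
lemma sameWeight_of_wedgeCoord_ne_zero (h₀ : Function.Injective a₀)
    (hT : ∀ (g : unitarySymplectic N) w, T (exteriorPower.map n (Matrix.toLin' g.1.1) w) =
      exteriorPower.map n (Matrix.toLin' g.1.1) (T w))
    {a : Fin n → Fin N ⊕ Fin N} (h : wedgeCoord a (T (wedge a₀)) ≠ 0) :
    Function.Injective a ∧ SameWeight a a₀ := by
  have ha : Function.Injective a := by
    by_contra ha
    exact h (by rw [wedgeCoord_eq_zero ha, LinearMap.zero_apply])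
  refine ⟨ha, sameWeight_of_prod_eq ha h₀ fun s => ?_⟩
  obtain ⟨g, hg⟩ := exists_torus s
  have h1 := hT g (wedge a₀)
  rw [hg, map_monomialMatrix_wedge, map_smul] at h1
  have h2 := congrArg (wedgeCoord (Equiv.refl _ ∘ a)) h1
  rw [wedgeCoord_map_monomialMatrix, map_smul, smul_eq_mul] at h2
  exact (mul_right_cancel₀ h h2).symm

/-- The conjugating permutation acts on `wedge a₀` by a sign and commutes with `T`, so the two
coordinates agree up to sign. -/
lemma wedgeCoord_eq_zero_of_card_inter (h₀ : Function.Injective a₀)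
    (hsub₀ : rightSites a₀ ⊆ leftSites a₀)
    (hT : ∀ (g : unitarySymplectic N) w, T (exteriorPower.map n (Matrix.toLin' g.1.1) w) =
      exteriorPower.map n (Matrix.toLin' g.1.1) (T w)) {a a' : Fin n → Fin N ⊕ Fin N}
    (ha : Function.Injective a) (ha' : Function.Injective a') (hw : SameWeight a a₀)
    (hw' : SameWeight a' a₀)
    (hcard : (rightSites a₀ ∩ rightSites a).card = (rightSites a₀ ∩ rightSites a').card)
    (h : wedgeCoord a (T (wedge a₀)) = 0) : wedgeCoord a' (T (wedge a₀)) = 0 := by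
  obtain ⟨σ, π, π₀, hπ, hπ₀⟩ := exists_perm_of_card_inter h₀ hsub₀ ha ha' hw hw' hcard
  obtain ⟨g, hg⟩ := exists_permutation σ
  have h1 := hT g (wedge a₀)
  rw [hg, map_monomialMatrix_wedge] at h1
  have h2 := congrArg (wedgeCoord (Equiv.sumCongr σ σ ∘ a)) h1
  rw [wedgeCoord_map_monomialMatrix, h, mul_zero] at h2
  simp only [Pi.one_apply, Finset.prod_const_one, one_smul] at h2
  rw [hπ, wedgeCoord_comp_perm]
  nth_rewrite 1 [hπ₀]
  rw [wedge_comp_perm]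
  rcases Int.units_eq_one_or (Equiv.Perm.sign π) with e | e <;>
    rcases Int.units_eq_one_or (Equiv.Perm.sign π₀) with e' | e' <;> simp [e, e', h2]

theorem finrank_matrixCommutant_le (hn : n ≤ 2 * N) :
    Module.finrank ℂ (matrixCommutant (exteriorRep N n)) ≤ n / 2 + 1 := by
  classical
  obtain ⟨a₀, h₀, hsub₀, hcard₀⟩ := exists_paired_tuple hn
  let b := (reindexedBasis (toLex : Fin N ⊕ Fin N ≃ Fin N ⊕ₗ Fin N)).exteriorPower n
  let P : ℕ → (Fin n → Fin N ⊕ Fin N) → Prop := fun t a =>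
    Function.Injective a ∧ SameWeight a a₀ ∧ (rightSites a₀ ∩ rightSites a).card = t
  -- One sample coordinate for each overlap size `t`; the zero functional stands in where no tuple
  -- has that overlap.
  let ψ : ℕ → ⋀[ℂ]^n (Fin N ⊕ Fin N → ℂ) →ₗ[ℂ] ℂ := fun t =>
    if h : ∃ a, P t a then wedgeCoord h.choose else 0
  let Φ : matrixCommutant (exteriorRep N n) →ₗ[ℂ] (Fin (n / 2 + 1) → ℂ) :=
    LinearMap.pi fun t => ψ t ∘ₗ LinearMap.applyₗ (wedge a₀) ∘ₗ
      (Matrix.toLin b b).toLinearMap ∘ₗ (matrixCommutant (exteriorRep N n)).subtype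
  have hΦ : Function.Injective Φ := by
    rw [← LinearMap.ker_eq_bot, LinearMap.ker_eq_bot']
    intro S hS
    let T := Matrix.toLin b b S.1
    have hT : ∀ (g : unitarySymplectic N) w, T (exteriorPower.map n (Matrix.toLin' g.1.1) w) =
        exteriorPower.map n (Matrix.toLin' g.1.1) (T w) := by
      intro g w
      have h1 := congrArg (Matrix.toLin b b) (S.2 g)
      rw [Matrix.toLin_mul b b b, Matrix.toLin_mul b b b] at h1
      have h2 : Matrix.toLin b b (exteriorRep N n g) =
          exteriorPower.map n (Matrix.toLin' g.1.1) := Matrix.toLin_toMatrix b b _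
      rw [h2] at h1
      exact (LinearMap.congr_fun h1 w).symm
    have hcoord : ∀ a, wedgeCoord a (T (wedge a₀)) = 0 := by
      intro a
      by_contra hne
      obtain ⟨ha, hw⟩ := sameWeight_of_wedgeCoord_ne_zero h₀ hT hne
      have hlt : (rightSites a₀ ∩ rightSites a).card < n / 2 + 1 := by
        have c1 := Finset.card_le_card (Finset.inter_subset_left (s₁ := rightSites a₀)
          (s₂ := rightSites a))
        have c2 := Finset.card_le_card hsub₀
        have c3 := card_leftSites_add_card_rightSites h₀
        omega
      have hex : ∃ a', P (rightSites a₀ ∩ rightSites a).card a' := ⟨a, ha, hw, rfl⟩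
      have h1 : ψ (rightSites a₀ ∩ rightSites a).card (T (wedge a₀)) = 0 :=
        congrFun hS ⟨_, hlt⟩
      simp only [ψ, dif_pos hex] at h1
      obtain ⟨hi, hw', hc⟩ := hex.choose_spec
      exact hne (wedgeCoord_eq_zero_of_card_inter h₀ hsub₀ hT hi ha hw' hw hc h1)
    -- The kernel is a stable subspace containing the generating wedge.
    have hker : LinearMap.ker T = ⊤ := by
      refine IsSpStable.eq_top (fun g w hw => ?_) h₀ hsub₀ hcard₀
        (LinearMap.mem_ker.2 (eq_zero_of_wedgeCoord hcoord))
      rw [LinearMap.mem_ker, hT, LinearMap.mem_ker.1 hw, map_zero]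
    have hT0 : T = 0 := LinearMap.ker_eq_top.1 hker
    exact Subtype.ext ((Matrix.toLin b b).injective (hT0.trans (map_zero _).symm))
  simpa using LinearMap.finrank_le_finrank_of_injective hΦ

end UpperBound

/-! ### The exact value of the integral. -/

section Evaluation

lemma integral_norm_secularCoeff_sq_of_le {n N : ℕ} (hn : n ≤ N) :
    ∫ U : unitarySymplectic N, ‖secularCoeff n U.1.1‖ ^ 2 ∂(unitarySymplecticHaar N) =
      (n / 2 + 1 : ℕ) := by
  rw [integral_norm_secularCoeff_sq, Nat.cast_inj]
  exact le_antisymm (finrank_matrixCommutant_le (by omega)) (le_finrank_matrixCommutant n N hn)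

lemma integral_norm_secularCoeff_sq_eq {n N : ℕ} (hn : n ≤ 2 * N) :
    ∫ U : unitarySymplectic N, ‖secularCoeff n U.1.1‖ ^ 2 ∂(unitarySymplecticHaar N) =
      (min n (2 * N - n) / 2 + 1 : ℕ) := by
  rcases le_total n N with h | h
  · rw [integral_norm_secularCoeff_sq_of_le h, min_eq_left (by omega)]
  · rw [min_eq_right (by omega), ← integral_norm_secularCoeff_sq_of_le (by omega : 2 * N - n ≤ N)]
    refine integral_congr_ae (ae_of_all _ fun U => ?_)
    have hcard : Fintype.card (Fin N ⊕ Fin N) = 2 * N := by simp [two_mul]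
    have := norm_secularCoeff_sub U.1.2 (n := n) (by rw [hcard]; exact hn)
    rw [hcard] at this
    change ‖secularCoeff n U.1.1‖ ^ 2 = ‖secularCoeff (2 * N - n) U.1.1‖ ^ 2
    rw [this]

lemma divisorIntegral_one {n N : ℕ} (hn : n ≤ 2 * N) :
    divisorIntegral 1 n N =
      ∫ U : unitarySymplectic N, ‖secularCoeff n U.1.1‖ ^ 2 ∂(unitarySymplecticHaar N) := by
  unfold divisorIntegral
  refine integral_congr_ae (ae_of_all _ fun U => ?_)
  have : (Finset.univ.filter fun j : Fin 1 → Fin (2 * N + 1) => ∑ i, (j i : ℕ) = n) =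
      {fun _ => ⟨n, by omega⟩} := by
    ext j
    simp only [Finset.mem_filter, Finset.mem_univ, true_and, Finset.mem_singleton,
      Fin.sum_univ_one]
    constructor
    · intro h
      ext i
      rw [Subsingleton.elim i 0, h]
    · rintro rfl
      rfl
  simp only [this, Finset.sum_singleton, Fin.prod_univ_one]

end Evaluation

/-! ### The main term and the asymptotics. -/

section Asymptotics

lemma floor_add_two_div_two (m : ℕ) : (⌊((m : ℝ) + 2) / 2⌋ : ℝ) = ((m / 2 + 1 : ℕ) : ℝ) := by
  have h1 : (2 : ℝ) * (m / 2 : ℕ) ≤ m := by exact_mod_cast (by omega : 2 * (m / 2) ≤ m)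
  have h2 : (m : ℝ) ≤ 2 * (m / 2 : ℕ) + 1 := by exact_mod_cast (by omega : m ≤ 2 * (m / 2) + 1)
  have : ⌊((m : ℝ) + 2) / 2⌋ = ((m / 2 + 1 : ℕ) : ℤ) := by
    rw [Int.floor_eq_iff]
    rw [Int.cast_natCast, Nat.cast_add, Nat.cast_one]
    constructor <;> linarith
  rw [this]
  norm_cast

/-- The form as a minimum gives continuity at once and matches the exact value. -/
lemma gammaSymplectic_eq_min (c : ℝ) : gammaSymplectic c = min c (2 - c) / 2 := by
  unfold gammaSymplectic
  split_ifs with h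
  · rw [min_eq_left (by linarith)]
  · rw [min_eq_right (by linarith)]

lemma continuous_gammaSymplectic : Continuous gammaSymplectic := by
  rw [funext gammaSymplectic_eq_min]
  fun_prop

lemma gammaSymplectic_mul {n N : ℕ} (hn : n ≤ 2 * N) (hN : 0 < N) :
    gammaSymplectic ((n : ℝ) / N) * N = ((min n (2 * N - n) : ℕ) : ℝ) / 2 := by
  have hN' : (0 : ℝ) < N := Nat.cast_pos.2 hN
  rw [gammaSymplectic_eq_min, div_mul_eq_mul_div, min_mul_of_nonneg _ _ hN'.le, Nat.cast_min,
    Nat.cast_sub hn, sub_mul, div_mul_cancel₀ _ hN'.ne']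
  push_cast
  rfl

lemma abs_divisorIntegral_sub_le {n N : ℕ} (hn : n ≤ 2 * N) (hN : 0 < N) :
    |divisorIntegral 1 n N - gammaSymplectic ((n : ℝ) / N) * N| ≤ 1 := by
  rw [divisorIntegral_one hn, integral_norm_secularCoeff_sq_eq hn, gammaSymplectic_mul hn hN]
  set m := min n (2 * N - n)
  have h1 : (2 : ℝ) * (m / 2 : ℕ) ≤ m := by exact_mod_cast (by omega : 2 * (m / 2) ≤ m)
  have h2 : (m : ℝ) ≤ 2 * (m / 2 : ℕ) + 1 := by exact_mod_cast (by omega : m ≤ 2 * (m / 2) + 1)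
  rw [abs_le, Nat.cast_add, Nat.cast_one]
  constructor <;> linarith

lemma isEquivalent_divisorIntegral {n N : ℕ → ℕ} (hn : ∀ i, n i ≤ 2 * N i)
    (hN : Tendsto N atTop atTop) (h1 : Tendsto n atTop atTop)
    (h2 : Tendsto (fun i => 2 * N i - n i) atTop atTop) :
    (fun i => divisorIntegral 1 (n i) (N i)) ~[atTop]
      (fun i => gammaSymplectic ((n i : ℝ) / (N i : ℝ)) * (N i : ℝ)) := by
  have hpos : ∀ᶠ i in atTop, 0 < N i := hN.eventually_gt_atTop 0
  have hO : (fun i => divisorIntegral 1 (n i) (N i) -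
      gammaSymplectic ((n i : ℝ) / (N i : ℝ)) * (N i : ℝ)) =O[atTop] (fun _ => (1 : ℝ)) := by
    refine IsBigO.of_bound 1 ?_
    filter_upwards [hpos] with i hi
    simpa using abs_divisorIntegral_sub_le (hn i) hi
  -- A bounded error is negligible because the main term `min n (2N - n) / 2` tends to infinity;
  -- both growth hypotheses enter here.
  refine hO.trans_isLittleO ((isLittleO_const_left (c := (1 : ℝ))).2 (Or.inr ?_))
  refine tendsto_norm_atTop_atTop.comp ?_
  have hmin : Tendsto (fun i => min (n i) (2 * N i - n i)) atTop atTop :=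
    tendsto_atTop.2 fun b => by
      filter_upwards [h1.eventually_ge_atTop b, h2.eventually_ge_atTop b] with i hi hi'
      exact le_min hi hi'
  have h3 : Tendsto (fun i => ((min (n i) (2 * N i - n i) : ℕ) : ℝ) / 2) atTop atTop :=
    (tendsto_natCast_atTop_atTop.comp hmin).atTop_div_const two_pos
  refine h3.congr' ?_
  filter_upwards [hpos] with i hi
  exact (gammaSymplectic_mul (hn i) hi).symm

lemma tendsto_divisorIntegral_div {n N : ℕ → ℕ} (hn : ∀ i, n i ≤ 2 * N i)
    (hN : Tendsto N atTop atTop) {c : ℝ}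
    (hc : Tendsto (fun i => (n i : ℝ) / (N i : ℝ)) atTop (𝓝 c)) :
    Tendsto (fun i => divisorIntegral 1 (n i) (N i) / (N i : ℝ)) atTop
      (𝓝 (gammaSymplectic c)) := by
  have hpos : ∀ᶠ i in atTop, 0 < N i := hN.eventually_gt_atTop 0
  have h1 : Tendsto (fun i => gammaSymplectic ((n i : ℝ) / (N i : ℝ))) atTop
      (𝓝 (gammaSymplectic c)) := (continuous_gammaSymplectic.tendsto c).comp hc
  have h2 : Tendsto (fun i => (1 : ℝ) / (N i : ℝ)) atTop (𝓝 0) :=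
    tendsto_one_div_atTop_nhds_zero_nat.comp hN
  have h3 : Tendsto (fun i => divisorIntegral 1 (n i) (N i) / (N i : ℝ) -
      gammaSymplectic ((n i : ℝ) / (N i : ℝ))) atTop (𝓝 0) := by
    refine squeeze_zero_norm' ?_ h2
    filter_upwards [hpos] with i hi
    have hi' : (0 : ℝ) < N i := Nat.cast_pos.2 hi
    rw [Real.norm_eq_abs, ← mul_div_cancel_right₀ (gammaSymplectic _) hi'.ne', ← sub_div, abs_div,
      abs_of_pos hi']
    exact div_le_div_of_nonneg_right (abs_divisorIntegral_sub_le (hn i) hi) hi'.le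
  simpa using h3.add h1

lemma isEquivalent_divisorIntegral_of_tendsto {n N : ℕ → ℕ} (hn : ∀ i, n i ≤ 2 * N i)
    (hN : Tendsto N atTop atTop) {c : ℝ}
    (hc : Tendsto (fun i => (n i : ℝ) / (N i : ℝ)) atTop (𝓝 c)) (h0 : 0 < c) (h2 : c < 2) :
    (fun i => divisorIntegral 1 (n i) (N i)) ~[atTop]
      (fun i => gammaSymplectic c * (N i : ℝ)) := by
  -- The endpoints `c = 0` and `c = 2` are excluded because `γ` vanishes there.
  have hγ : gammaSymplectic c ≠ 0 := by
    rw [gammaSymplectic_eq_min]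
    have : 0 < min c (2 - c) := lt_min h0 (by linarith)
    positivity
  refine isEquivalent_of_tendsto_one ?_
  have := (tendsto_divisorIntegral_div hn hN hc).div_const (gammaSymplectic c)
  rw [div_self hγ] at this
  refine this.congr fun i => ?_
  rw [Pi.div_apply, div_div, mul_comm]

end Asymptotics

theorem mainTheorem12 :
    -- the exact evaluation
    (∀ n N : ℕ, n ≤ 2 * N →
      divisorIntegral 1 n N =
          ∫ U : unitarySymplectic N, ‖secularCoeff n U.1.1‖ ^ 2 ∂(unitarySymplecticHaar N) ∧
      (n ≤ N →
        ∫ U : unitarySymplectic N, ‖secularCoeff n U.1.1‖ ^ 2 ∂(unitarySymplecticHaar N) =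
          (⌊((n : ℝ) + 2) / 2⌋ : ℝ)) ∧
      (N + 1 ≤ n →
        ∫ U : unitarySymplectic N, ‖secularCoeff n U.1.1‖ ^ 2 ∂(unitarySymplecticHaar N) =
          (⌊(2 * (N : ℝ) - (n : ℝ) + 2) / 2⌋ : ℝ))) ∧
    -- the asymptotics, along arbitrary sequences of admissible pairs
    (∀ n N : ℕ → ℕ, (∀ i, n i ≤ 2 * N i) → Tendsto N atTop atTop →
      -- with `c = n / N`, away from the zeros of the main term
      (Tendsto n atTop atTop → Tendsto (fun i => 2 * N i - n i) atTop atTop →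
        (fun i => divisorIntegral 1 (n i) (N i)) ~[atTop]
          (fun i => gammaSymplectic ((n i : ℝ) / (N i : ℝ)) * (N i : ℝ))) ∧
      -- with `n / N` converging to `c` (in particular with `n / N = c` fixed)
      (∀ c : ℝ, Tendsto (fun i => (n i : ℝ) / (N i : ℝ)) atTop (𝓝 c) →
        Tendsto (fun i => divisorIntegral 1 (n i) (N i) / (N i : ℝ)) atTop
          (𝓝 (gammaSymplectic c)) ∧
        (0 < c → c < 2 →
          (fun i => divisorIntegral 1 (n i) (N i)) ~[atTop]
            (fun i => gammaSymplectic c * (N i : ℝ))))) := by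
  refine ⟨fun n N hn => ⟨divisorIntegral_one hn, fun h => ?_, fun h => ?_⟩,
    fun n N hn hN => ⟨isEquivalent_divisorIntegral hn hN, fun c hc =>
      ⟨tendsto_divisorIntegral_div hn hN hc,
        isEquivalent_divisorIntegral_of_tendsto hn hN hc⟩⟩⟩
  · rw [integral_norm_secularCoeff_sq_eq hn, min_eq_left (by omega), floor_add_two_div_two]
  · rw [integral_norm_secularCoeff_sq_eq hn, min_eq_right (by omega), ← floor_add_two_div_two,
      Nat.cast_sub hn]
    push_cast
    rfl
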